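/- For an integer $\alpha\neq 1$ let $G(\alpha)=\langle A,B\mid A^{[A,B]}=A^{\alpha},\ B^{[B,A]}=B^{\alpha}\rangle$, where $[a,b]=a^{-1}b^{-1}ab$ and $b^{a}=a^{-1}ba$. Let $m=v_2(\alpha-1)$ be the exponent of $2$ in the factorization of $\alpha-1$, suppose that $m>1$, and let $J$ be a Sylow $2$-subgroup of $G(\alpha)$. Write $1=Z_0(J)\le Z_1(J)\le Z_2(J)\le\cdots$ for the upper central series of $J$. Then: 1. $Z_3(J)$ is abelian of order $2^{4m-2}$, and it has the presentation $$\langle x,y,z\mid xy=yx,\ xz=zx,\ yz=zy,\ x^{2^{2m-2}}=z^{2^m},\ x^{2^{m-1}}y^{2^{m-1}}=1,\ x^{2^{2m-1}}=1\rangle .$$ 2. $J/Z_3(J)\cong \mathrm{Heis}(\mathbb{Z}/2^m\mathbb{Z})/U$, where $\mathrm{Heis}(R)$ is the group of upper unitriangular $3\times 3$ matrices over $R$, and $U$ is the subgroup generated by all $t^{2^{m-1}}$ with $t$ in the center of $\mathrm{Heis}(\mathbb{Z}/2^m\mathbb{Z})$. 3. $J$ has exponent $2^{3m-1}$. -/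

import Mathlib

namespace Macdonald

/-- The commutator `[a, b] = a⁻¹ b⁻¹ a b` (Mathlib's `⁅a, b⁆` is `a b a⁻¹ b⁻¹`). -/
def comm {T : Type*} [Group T] (a b : T) : T := a⁻¹ * b⁻¹ * a * b

/-- The conjugate `b ^ a = a⁻¹ b a`. -/
def conj {T : Type*} [Group T] (b a : T) : T := a⁻¹ * b * a

/-- The relators `A^[A,B] A^(-α)` and `B^[B,A] B^(-α)`, where `A`, `B` are the free generators. -/
def macdonaldRels (α : ℤ) : Set (FreeGroup (Fin 2)) :=
  let A : FreeGroup (Fin 2) := FreeGroup.of 0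
  let B : FreeGroup (Fin 2) := FreeGroup.of 1
  {conj A (comm A B) * (A ^ α)⁻¹, conj B (comm B A) * (B ^ α)⁻¹}

/-- The Macdonald group `G(α) = ⟨A, B | A^[A,B] = A^α, B^[B,A] = B^α⟩`. -/
abbrev MacdonaldGroup (α : ℤ) : Type := PresentedGroup (macdonaldRels α)

/-- The relators of
`⟨x, y, z | xy = yx, xz = zx, yz = zy, x^(2^(2m-2)) = z^(2^m), x^(2^(m-1)) y^(2^(m-1)) = 1,
x^(2^(2m-1)) = 1⟩`; it is used only for `m > 1`, where no exponent is truncated. -/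
def thirdCenterRels (m : ℕ) : Set (FreeGroup (Fin 3)) :=
  let x : FreeGroup (Fin 3) := FreeGroup.of 0
  let y : FreeGroup (Fin 3) := FreeGroup.of 1
  let z : FreeGroup (Fin 3) := FreeGroup.of 2
  {x * y * (y * x)⁻¹, x * z * (z * x)⁻¹, y * z * (z * y)⁻¹,
    x ^ 2 ^ (2 * m - 2) * (z ^ 2 ^ m)⁻¹,
    x ^ 2 ^ (m - 1) * y ^ 2 ^ (m - 1),
    x ^ 2 ^ (2 * m - 1)}

/-- The Heisenberg group over `R`: the triple `(a, b, c)` is the unitriangular matrix with rows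
`(1, a, c)`, `(0, 1, b)`, `(0, 0, 1)`, see `Heis.toMatrix`. -/
@[ext]
structure Heis (R : Type*) where
  a : R
  b : R
  c : R

namespace Heis

variable {R : Type*} [Ring R]

/-- The unitriangular matrix of an element of the Heisenberg group. -/
def toMatrix (g : Heis R) : Matrix (Fin 3) (Fin 3) R :=
  !![1, g.a, g.c; 0, 1, g.b; 0, 0, 1]

instance : Mul (Heis R) := ⟨fun g h => ⟨g.a + h.a, g.b + h.b, g.c + h.c + g.a * h.b⟩⟩

instance : One (Heis R) := ⟨⟨0, 0, 0⟩⟩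

instance : Inv (Heis R) := ⟨fun g => ⟨-g.a, -g.b, -g.c + g.a * g.b⟩⟩

@[simp] theorem mul_a (g h : Heis R) : (g * h).a = g.a + h.a := rfl
@[simp] theorem mul_b (g h : Heis R) : (g * h).b = g.b + h.b := rfl
@[simp] theorem mul_c (g h : Heis R) : (g * h).c = g.c + h.c + g.a * h.b := rfl
@[simp] theorem one_a : (1 : Heis R).a = 0 := rfl
@[simp] theorem one_b : (1 : Heis R).b = 0 := rfl
@[simp] theorem one_c : (1 : Heis R).c = 0 := rfl
@[simp] theorem inv_a (g : Heis R) : (g⁻¹).a = -g.a := rfl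
@[simp] theorem inv_b (g : Heis R) : (g⁻¹).b = -g.b := rfl
@[simp] theorem inv_c (g : Heis R) : (g⁻¹).c = -g.c + g.a * g.b := rfl

instance : Group (Heis R) :=
  Group.ofLeftAxioms
    (fun g h k => by ext <;> simp [add_assoc, mul_add, add_mul]; abel)
    (fun g => by ext <;> simp)
    (fun g => by ext <;> simp)

/-- The group law is matrix multiplication. -/
theorem toMatrix_mul (g h : Heis R) : (g * h).toMatrix = g.toMatrix * h.toMatrix := by
  ext i j
  fin_cases i <;> fin_cases j <;>
    simp [toMatrix, Matrix.mul_apply, Fin.sum_univ_three, add_comm, add_assoc]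

/-- The neutral element is the identity matrix. -/
theorem toMatrix_one : (1 : Heis R).toMatrix = 1 := by
  ext i j
  fin_cases i <;> fin_cases j <;> simp [toMatrix]

/-- Distinct elements have distinct matrices. -/
theorem toMatrix_injective : Function.Injective (toMatrix : Heis R → Matrix (Fin 3) (Fin 3) R) := by
  intro g h e
  have h1 := congrFun (congrFun e 0) 1
  have h2 := congrFun (congrFun e 1) 2
  have h3 := congrFun (congrFun e 0) 2
  simp [toMatrix] at h1 h2 h3
  exact Heis.ext h1 h2 h3

end Heis

/-- `T ^ n`: the subgroup of `T` generated by all `t ^ n` with `t ∈ T`. -/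
def powSubgroup (T : Type*) [Group T] (n : ℤ) : Subgroup T :=
  Subgroup.closure (Set.range fun t : T => t ^ n)

/-- The `n`-th power of the center of `T`, as a subgroup of `T`. -/
def centerPow (T : Type*) [Group T] (n : ℤ) : Subgroup T :=
  (powSubgroup (Subgroup.center T) n).map (Subgroup.center T).subtype

instance centerPow_normal (T : Type*) [Group T] (n : ℤ) : (centerPow T n).Normal := by
  refine ⟨fun x hx g => ?_⟩
  obtain ⟨⟨y, hy⟩, hyn, rfl⟩ := hx
  have : g * y * g⁻¹ = y := by
    rw [Subgroup.mem_center_iff.1 hy g, mul_inv_cancel_right]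
  exact ⟨⟨y, hy⟩, hyn, this.symm⟩

end Macdonald

/-! Put h = 2^(m-1), so that α = 1 + 2hv with v odd, and let c = [A,B]. The relations say that c
acts on powers of A, and c⁻¹ on powers of B, by the exponent α. Evaluating one product in two ways,
when n-th powers agree with α^i-th powers on A and B, shows that a certain power of B is also a
power of A, hence central, with exponent `defect α n`. This makes A and B torsion, with orders built
only from primes dividing α - 1; G(α) is then finite and nilpotent, and J is a quotient of it,
generated by the images a, b of A, B.

In J the same identity gives a^(4h³) = 1, a^(2h²) b^(2h²) = 1 and c^(2h²) = a^(2h³). Since every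
element has the form a^i c^k b^j, this bounds |J| by 16h^7. Conversely, explicit permutations of a
set of 16h^7 exponent triples satisfy the relations and act transitively, so |J| = 16h^7, and two
normal forms agree exactly when their exponents differ by the lattice of these three relations
(`SylowPair.normalForm_eq_iff`).

The rest is computation with exponents: Z₁ = ⟨a^(2h²)⟩, Z₂ = ⟨a^(2h²), c^h⟩, Z₃ = ⟨a^(2h), c^h,
b^(2h)⟩. The lattice restricted to Z₃ gives its order and presentation. Sending a, b to the
elementary unitriangular matrices over ℤ/2h identifies Z₃ with the preimage of U. Finally x^(2h)
lies in Z₃, which has exponent dividing 2h², while a has order 4h³. -/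

namespace Macdonald

/-! ### Consequences of the defining relations. -/

/-- The elements `a`, `b` satisfy the defining relations of the Macdonald group `G(α)`. -/
structure MacPair {T : Type*} [Group T] (α : ℤ) (a b : T) : Prop where
  left : conj a (comm a b) = a ^ α
  right : conj b (comm b a) = b ^ α

/-- The sum `1 + α + ⋯ + α ^ (n - 1)`. -/
def geom (α : ℤ) (n : ℕ) : ℤ := ∑ t ∈ Finset.range n, α ^ t

theorem geom_mul (α : ℤ) (n : ℕ) : geom α n * (α - 1) = α ^ n - 1 := geom_sum_mul α n

theorem geom_zero (α : ℤ) : geom α 0 = 0 := by simp [geom]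

theorem geom_succ (α : ℤ) (n : ℕ) : geom α (n + 1) = α * geom α n + 1 := geom_sum_succ

theorem geom_succ' (α : ℤ) (n : ℕ) : geom α (n + 1) = geom α n + α ^ n :=
  Finset.sum_range_succ _ _

/-- The exponent by which the relation `A ^ (B ^ n)` deviates from being trivial. -/
def defect (α : ℤ) (n : ℕ) : ℤ := n * α ^ n - α * geom α n

theorem defect_mul (α : ℤ) (n : ℕ) :
    defect α n * (α - 1) = α ^ n * (n * (α - 1) - α) + α := by
  have := geom_mul α n
  unfold defect
  linear_combination (-α) * this

theorem comm_swap {T : Type*} [Group T] (a b : T) : comm b a = (comm a b)⁻¹ := by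
  simp [comm, mul_assoc]

namespace MacPair

variable {T : Type*} [Group T] {α : ℤ} {a b : T}

theorem swap (h : MacPair α a b) : MacPair α b a := ⟨h.right, h.left⟩

theorem map {S : Type*} [Group S] (f : T →* S) (h : MacPair α a b) :
    MacPair α (f a) (f b) := by
  have h1 := congrArg f h.left
  have h2 := congrArg f h.right
  constructor
  · simpa [conj, comm] using h1
  · simpa [conj, comm] using h2

theorem zpow_mul_comm (h : MacPair α a b) (z : ℤ) :
    a ^ z * comm a b = comm a b * a ^ (α * z) := by
  have h1 : (comm a b)⁻¹ * a ^ z * comm a b = a ^ (α * z) := by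
    have h2 : (comm a b)⁻¹ * a ^ z * comm a b = ((comm a b)⁻¹ * a * comm a b) ^ z := by
      have := conj_zpow (i := z) (a := (comm a b)⁻¹) (b := a)
      rw [inv_inv] at this
      exact this.symm
    rw [h2, zpow_mul]
    exact congrArg (· ^ z) h.left
  rw [← h1]; group

theorem comm_mul_zpow (h : MacPair α a b) (z : ℤ) :
    comm a b * b ^ z = b ^ (α * z) * comm a b := by
  have := h.swap.zpow_mul_comm z
  rw [comm_swap a b] at this
  calc comm a b * b ^ z = comm a b * (b ^ z * (comm a b)⁻¹) * comm a b := by group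
    _ = _ := by rw [this]; group

theorem zpow_mul_comm_pow (h : MacPair α a b) (z : ℤ) (n : ℕ) :
    a ^ z * comm a b ^ n = comm a b ^ n * a ^ (α ^ n * z) := by
  induction n generalizing z with
  | zero => simp
  | succ n ih =>
    rw [pow_succ', ← mul_assoc, h.zpow_mul_comm, mul_assoc, ih, ← mul_assoc]
    congr 2; ring

theorem comm_pow_mul_zpow (h : MacPair α a b) (z : ℤ) (n : ℕ) :
    comm a b ^ n * b ^ z = b ^ (α ^ n * z) * comm a b ^ n := by
  induction n generalizing z with
  | zero => simp
  | succ n ih =>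
    rw [pow_succ, mul_assoc, h.comm_mul_zpow, ← mul_assoc, ih, mul_assoc]
    congr 2; ring

theorem pow_mul_right (h : MacPair α a b) (n : ℕ) :
    a ^ n * b = b * (comm a b ^ n * a ^ (α * geom α n)) := by
  induction n with
  | zero => simp [geom_zero]
  | succ n ih =>
    have h1 : a * b = b * (a * comm a b) := by simp [comm, mul_assoc]
    have h2 : a ^ (α * geom α n) * a * comm a b = comm a b * a ^ (α * geom α (n + 1)) := by
      rw [← zpow_add_one, h.zpow_mul_comm, geom_succ]
    calc a ^ (n + 1) * b = a ^ n * b * (a * comm a b) := by rw [pow_succ, mul_assoc, h1]; group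
      _ = b * (comm a b ^ n * (a ^ (α * geom α n) * a * comm a b)) := by rw [ih]; group
      _ = _ := by rw [h2, pow_succ]; group

theorem pow_mul_left (h : MacPair α a b) (n : ℕ) :
    b ^ n * a = a * ((comm a b ^ n)⁻¹ * b ^ (α * geom α n)) := by
  have := h.swap.pow_mul_right n
  rwa [comm_swap a b, inv_pow] at this

/-- The hypotheses turn the action of c^i into n-th powers: a c^i = c^i a^n and c^i b = b^n c^i.
Thus a b^n c^i equals a c^i b = c^i a^n b, and `pow_mul_right` and `pow_mul_left` evaluate the two
sides differently; the discrepancy is the defect. -/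
theorem zpow_defect_mul_comm_pow (h : MacPair α a b) {n i : ℕ} (ha : a ^ n = a ^ α ^ i)
    (hb : b ^ n = b ^ α ^ i) :
    b ^ defect α n * comm a b ^ (n + i) = comm a b ^ (n + i) * a ^ (-defect α n) := by
  set c := comm a b with hc
  have e1 : c ^ i * b = b ^ n * c ^ i := by
    have := h.comm_pow_mul_zpow 1 i
    rw [zpow_one, mul_one, ← hb] at this
    exact this
  have e2 : a * c ^ i = c ^ i * a ^ n := by
    have := h.zpow_mul_comm_pow 1 i
    rw [zpow_one, mul_one, ← ha] at this
    exact this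
  have e3 : c ^ n * b ^ n = b ^ (α ^ n * n) * c ^ n := by
    have := h.comm_pow_mul_zpow n n
    rwa [zpow_natCast] at this
  have w1 : a * b ^ n * c ^ i = b ^ n * (c ^ (n + i) * a ^ (α * geom α n)) := by
    calc a * b ^ n * c ^ i = a * (b ^ n * c ^ i) := by group
      _ = (a * c ^ i) * b := by rw [← e1]; group
      _ = c ^ i * (a ^ n * b) := by rw [e2]; group
      _ = (c ^ i * b) * (c ^ n * a ^ (α * geom α n)) := by rw [h.pow_mul_right, ← hc]; group
      _ = _ := by rw [e1, add_comm n i, pow_add]; group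
  have w2 : a * b ^ n = b ^ n * (a * b ^ defect α n * c ^ n) := by
    have e4 : a = b ^ n * a * (b ^ (-(α * geom α n)) * c ^ n) := by
      rw [h.pow_mul_left, ← hc]; group
    calc a * b ^ n = b ^ n * a * (b ^ (-(α * geom α n)) * c ^ n) * b ^ n := by rw [← e4]
      _ = b ^ n * a * b ^ (-(α * geom α n)) * (c ^ n * b ^ n) := by group
      _ = b ^ n * a * (b ^ (-(α * geom α n)) * b ^ (α ^ n * n)) * c ^ n := by rw [e3]; group
      _ = _ := by rw [← zpow_add, defect]; rw [show -(α * geom α n) + α ^ n * n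
                    = n * α ^ n - α * geom α n by ring]; group
  have w3 : b ^ defect α n * c ^ (n + i) = a⁻¹ * c ^ (n + i) * a ^ (α * geom α n) := by
    have : b ^ n * (c ^ (n + i) * a ^ (α * geom α n))
        = b ^ n * (a * b ^ defect α n * c ^ (n + i)) := by
      rw [← w1, w2, pow_add]; group
    have := mul_left_cancel this
    rw [mul_assoc, this]; group
  have e5 : a⁻¹ * c ^ (n + i) = c ^ (n + i) * a ^ (-(n * α ^ n) : ℤ) := by
    have := h.zpow_mul_comm_pow (-1) (n + i)
    rw [zpow_neg_one] at this
    have e6 : a ^ (-(n * α ^ n) : ℤ) = a ^ (α ^ (n + i) * -1) := by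
      rw [show α ^ (n + i) * -1 = α ^ i * -α ^ n by ring, zpow_mul, ← ha, ← zpow_natCast a n,
        ← zpow_mul]
      congr 1; ring
    rw [this, e6]
  rw [w3, e5, mul_assoc, ← zpow_add, defect]
  congr 2; ring

/-- Conjugation by c^(n+i) takes b^δ to a^(-δ), where δ is the defect. Raising this to the power
α^(n+i), which on powers of b undoes the conjugation, leaves b^δ as a power of a. It therefore
commutes with a, b and c, while c also multiplies exponents of b by α; hence the later relation
b^(δ(α-1)) = 1. -/
theorem zpow_defect_eq (h : MacPair α a b) {n i : ℕ} (ha : a ^ n = a ^ α ^ i)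
    (hb : b ^ n = b ^ α ^ i) :
    b ^ defect α n = a ^ (-defect α n * α ^ (n + i)) := by
  have k := h.zpow_defect_mul_comm_pow ha hb
  set c := comm a b with hc
  have k2 : (c ^ (n + i))⁻¹ * b ^ defect α n * c ^ (n + i) = a ^ (-defect α n) := by
    rw [mul_assoc, k]; group
  have k3 := conj_zpow (i := α ^ (n + i)) (a := (c ^ (n + i))⁻¹) (b := b ^ defect α n)
  rw [inv_inv, k2, ← zpow_mul, ← zpow_mul, mul_comm (defect α n), mul_assoc _ _ (c ^ (n + i)),
    ← h.comm_pow_mul_zpow] at k3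
  rw [k3, ← hc]; group

theorem commute_zpow_defect (h : MacPair α a b) {n i : ℕ} (ha : a ^ n = a ^ α ^ i)
    (hb : b ^ n = b ^ α ^ i) : Commute (b ^ defect α n) a ∧
      Commute (b ^ defect α n) (comm a b) := by
  have h1 : Commute (b ^ defect α n) a := by
    rw [h.zpow_defect_eq ha hb]
    exact Commute.zpow_left (Commute.refl a) _
  have h2 : Commute (b ^ defect α n) b := Commute.zpow_left (Commute.refl b) _
  exact ⟨h1, ((h1.inv_right.mul_right h2.inv_right).mul_right h1).mul_right h2⟩

theorem right_zpow_defect_mul (h : MacPair α a b) {n i : ℕ} (ha : a ^ n = a ^ α ^ i)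
    (hb : b ^ n = b ^ α ^ i) : b ^ (defect α n * (α - 1)) = 1 := by
  have h1 := (h.commute_zpow_defect ha hb).2
  have h2 := h.comm_mul_zpow (defect α n)
  rw [← h1.eq] at h2
  have h3 := mul_right_cancel h2
  rw [show defect α n * (α - 1) = α * defect α n - defect α n by ring, zpow_sub, ← h3,
    mul_inv_cancel]

theorem left_zpow_defect_mul (h : MacPair α a b) {n i : ℕ} (ha : a ^ n = a ^ α ^ i)
    (hb : b ^ n = b ^ α ^ i) : a ^ (defect α n * (α - 1)) = 1 :=
  h.swap.right_zpow_defect_mul hb ha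

theorem zpow_defect_mul_zpow_defect (h : MacPair α a b) {n i : ℕ} (ha : a ^ n = a ^ α ^ i)
    (hb : b ^ n = b ^ α ^ i) : a ^ defect α n * b ^ defect α n = 1 := by
  have h1 := (h.commute_zpow_defect ha hb).2.pow_right (n + i)
  have h2 := h.zpow_defect_mul_comm_pow ha hb
  rw [h1.eq] at h2
  rw [mul_left_cancel h2]; group

end MacPair

/-! ### Divisibility of geometric sums and the primes dividing the orders of the generators. -/

theorem geom_add (α : ℤ) (m n : ℕ) : geom α (m + n) = geom α m + α ^ m * geom α n := by
  induction n with
  | zero => simp [geom_zero]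
  | succ n ih => rw [← add_assoc, geom_succ', geom_succ', ih]; ring

theorem geom_mul_index (α : ℤ) (m n : ℕ) : geom α (n * m) = geom α m * geom (α ^ m) n := by
  induction n with
  | zero => simp [geom_zero]
  | succ n ih => rw [Nat.succ_mul, geom_add, ih, geom_succ']; ring

theorem geom_modEq {β q : ℤ} (hβ : β ≡ 1 [ZMOD q]) (n : ℕ) : geom β n ≡ n [ZMOD q] := by
  induction n with
  | zero => simp [geom_zero]
  | succ n ih =>
    rw [geom_succ']
    push_cast
    exact ih.add (by simpa using hβ.pow n)

/-- Peel off one prime p at a time: the sum of length pn factors as the sum of length n times a sum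
of p terms, each ≡ 1 modulo p. -/
theorem dvd_geom (α : ℤ) (n : ℕ) :
    (∀ q : ℕ, q.Prime → q ∣ n → (q : ℤ) ∣ α - 1) → (n : ℤ) ∣ geom α n := by
  induction n using induction_on_primes with
  | zero => simp [geom_zero]
  | one => simp
  | prime_mul p n hp ih =>
    intro H
    have h1 := ih fun q hq hqn => H q hq (hqn.mul_left p)
    have h2 : α ≡ 1 [ZMOD p] := (Int.modEq_iff_dvd.2 (H p hp (dvd_mul_right p n))).symm
    have h3 : α ^ n ≡ 1 [ZMOD p] := by simpa using h2.pow n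
    have h4 : (p : ℤ) ∣ geom (α ^ n) p :=
      (Int.modEq_zero_iff_dvd).1 ((geom_modEq h3 p).trans (Int.modEq_zero_iff_dvd.2 dvd_rfl))
    rw [geom_mul_index]
    push_cast
    rw [mul_comm]
    exact mul_dvd_mul h1 h4

/-- Strong induction on p. Let d be the order of α modulo p; it divides N and is less than p, so its
primes divide α - 1 by induction. If d > 1, put e = d / q with q the least prime of d; then α^e ≡ 1
modulo d. For n ≡ α^e modulo N this gives x^n = x, and the hypothesis collapses to x (x^e - 1)(x -
1) = 0 modulo p, contradicting the order of x. -/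
theorem prime_dvd_sub_one {α : ℤ} {N : ℕ} (hN : 0 < N) (hcop : IsCoprime (N : ℤ) α)
    (H : ∀ n i : ℕ, (n : ℤ) ≡ α ^ i [ZMOD N] → (N : ℤ) ∣ defect α n * (α - 1)) (p : ℕ) :
    p.Prime → p ∣ N → (p : ℤ) ∣ α - 1 := by
  induction p using Nat.strong_induction_on with
  | _ p ih =>
  intro hp hpN
  have : Fact p.Prime := ⟨hp⟩
  set x : ZMod p := (α : ZMod p) with hx
  have hN0 : ((N : ℕ) : ZMod p) = 0 := (ZMod.natCast_eq_zero_iff N p).2 hpN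
  have hx0 : x ≠ 0 := by
    intro h0
    have h1 : (p : ℤ) ∣ α := (ZMod.intCast_zmod_eq_zero_iff_dvd α p).1 h0
    have h2 := hcop.isUnit_of_dvd' (Int.natCast_dvd_natCast.2 hpN) h1
    exact hp.one_lt.ne' (by simpa using Int.isUnit_iff_natAbs_eq.1 h2)
  have key : ∀ n i : ℕ, (n : ℤ) ≡ α ^ i [ZMOD N] →
      x ^ n * ((n : ZMod p) * (x - 1) - x) + x = 0 := by
    intro n i h
    have h1 : (p : ℤ) ∣ defect α n * (α - 1) :=
      (Int.natCast_dvd_natCast.2 hpN).trans (H n i h)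
    rw [defect_mul] at h1
    have := (ZMod.intCast_zmod_eq_zero_iff_dvd _ p).2 h1
    push_cast at this
    exact this
  have hxN : x ^ N = 1 := by
    -- With n = N + 1 and i = 0 the condition reads x^(N+1) = x, so the order of x divides N.
    have := key (N + 1) 0 (by simp [Int.ModEq])
    push_cast at this
    rw [hN0] at this
    have h2 : x * (x ^ N - 1) = 0 := by linear_combination -this
    exact sub_eq_zero.1 ((mul_eq_zero.1 h2).resolve_left hx0)
  set d := orderOf x with hd
  have hdN : d ∣ N := orderOf_dvd_of_pow_eq_one hxN
  have hdp : d < p := by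
    have h1 : d ∣ p - 1 := orderOf_dvd_of_pow_eq_one (ZMod.pow_card_sub_one_eq_one hx0)
    have := Nat.le_of_dvd (Nat.sub_pos_of_lt hp.one_lt) h1
    have := hp.one_lt
    omega
  have hdpos : 0 < d := Nat.pos_of_dvd_of_pos hdN hN
  have hq : ∀ q : ℕ, q.Prime → q ∣ d → (q : ℤ) ∣ α - 1 := fun q hq hqd =>
    ih q ((Nat.le_of_dvd hdpos hqd).trans_lt hdp) hq (hqd.trans hdN)
  by_cases hd1 : d = 1
  · have h1 : x = 1 := orderOf_eq_one_iff.1 hd1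
    apply (ZMod.intCast_zmod_eq_zero_iff_dvd _ p).1
    push_cast
    rw [← hx, h1, sub_self]
  exfalso
  obtain ⟨e, he⟩ := Nat.minFac_dvd d
  have hmp := Nat.minFac_prime hd1
  have hepos : 0 < e := Nat.pos_of_ne_zero fun h => by rw [h, mul_zero] at he; omega
  have hed : e < d := by
    rw [he]; exact lt_mul_of_one_lt_left hepos hmp.one_lt
  have hdvd : (d : ℤ) ∣ α ^ e - 1 := by
    rw [← geom_mul, he, Nat.cast_mul, mul_comm]
    refine mul_dvd_mul
      (dvd_geom α e fun q hq' hqe => hq q hq' (hqe.trans (Dvd.intro_left _ he.symm)))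
      (hq _ hmp (Nat.minFac_dvd d))
  obtain ⟨n, hn⟩ : ∃ n : ℕ, (n : ℤ) ≡ α ^ e [ZMOD N] := by
    refine ⟨(α ^ e % N).toNat, ?_⟩
    rw [Int.toNat_of_nonneg (Int.emod_nonneg _ (by positivity))]
    exact Int.mod_modEq _ _
  have hn1 : n ≡ 1 [MOD d] := by
    apply (Int.natCast_modEq_iff).1
    push_cast
    exact (hn.of_dvd (Int.natCast_dvd_natCast.2 hdN)).trans (Int.modEq_iff_dvd.2 hdvd).symm
  have hxn : x ^ n = x := by
    rw [← pow_mod_orderOf, ← hd, hn1, hd, pow_mod_orderOf, pow_one]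
  have hnx : (n : ZMod p) = x ^ e := by
    have := (ZMod.intCast_eq_intCast_iff _ _ p).2 (hn.of_dvd (Int.natCast_dvd_natCast.2 hpN))
    push_cast at this
    exact this
  have h3 := key n e hn
  rw [hxn, hnx] at h3
  have h4 : x * ((x ^ e - 1) * (x - 1)) = 0 := by linear_combination h3
  rcases mul_eq_zero.1 ((mul_eq_zero.1 h4).resolve_left hx0) with h5 | h5
  · exact absurd (orderOf_le_of_pow_eq_one hepos (sub_eq_zero.1 h5)) (not_le.2 hed)
  · exact hd1 (orderOf_eq_one_iff.2 (sub_eq_zero.1 h5))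

theorem exists_dvd_pow {N w : ℕ} : (hN : N ≠ 0) → (∀ p : ℕ, p.Prime → p ∣ N → p ∣ w) →
    ∃ l, N ∣ w ^ l := by
  induction N using induction_on_primes with
  | zero => simp
  | one => exact fun _ _ => ⟨0, by simp⟩
  | prime_mul p n hp ih =>
    intro h0 H
    obtain ⟨l, hl⟩ := ih (by rintro rfl; simp at h0) fun q hq hqn => H q hq (hqn.mul_left p)
    exact ⟨l + 1, by rw [pow_succ']; exact mul_dvd_mul (H p hp (dvd_mul_right p n)) hl⟩

/-! ### Nilpotency by descent along the upper central series. -/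

open scoped commutatorElement

/-- The centralizer of x modulo N is a subgroup, so generators suffice. This also passes from `comm`
to the bracket ⁅x, y⁆ used by the upper central series. -/
theorem comm_mem_of_closure {T : Type*} [Group T] {s : Set T} (hs : Subgroup.closure s = ⊤)
    {N : Subgroup T} [N.Normal] {x : T} (h : ∀ y ∈ s, comm x y ∈ N) (y : T) : ⁅x, y⁆ ∈ N := by
  have key : ∀ y : T, Commute (x : T ⧸ N) (y : T ⧸ N) := by
    intro y
    have hy : y ∈ Subgroup.closure s := hs ▸ Subgroup.mem_top y
    induction hy using Subgroup.closure_induction with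
    | mem y hy =>
      have := (QuotientGroup.eq_one_iff (N := N) _).2 (h y hy)
      rw [comm, mul_assoc, ← mul_inv_rev, QuotientGroup.mk_mul, QuotientGroup.mk_inv,
        inv_mul_eq_one] at this
      rw [Commute, SemiconjBy, ← QuotientGroup.mk_mul, ← QuotientGroup.mk_mul, ← this]
    | one => exact Commute.one_right _
    | mul y z _ _ hy hz => exact hy.mul_right hz
    | inv y _ hy => exact hy.inv_right
  rw [← QuotientGroup.eq_one_iff, ← QuotientGroup.mk'_apply, map_commutatorElement]
  exact commutatorElement_eq_one_iff_commute.2 (key y)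

theorem mem_upperCentralSeries_succ {T : Type*} [Group T] {s : Set T}
    (hs : Subgroup.closure s = ⊤) {k : ℕ} {x : T}
    (h : ∀ y ∈ s, comm x y ∈ Subgroup.upperCentralSeries T k) :
    x ∈ Subgroup.upperCentralSeries T (k + 1) :=
  Subgroup.mem_upperCentralSeries_succ_iff.2 (comm_mem_of_closure hs h)

theorem comm_mem_upperCentralSeries {T : Type*} [Group T] {k : ℕ} {x : T}
    (hx : x ∈ Subgroup.upperCentralSeries T (k + 1)) (y : T) :
    comm x y ∈ Subgroup.upperCentralSeries T k := by
  have h := Subgroup.mem_upperCentralSeries_succ_iff.1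
    (inv_mem hx : x⁻¹ ∈ Subgroup.upperCentralSeries T (k + 1)) y⁻¹
  rwa [commutatorElement_def, inv_inv, inv_inv] at h

/-- Induction on l through `geom_mul_index`, with the factor of length v expanded to second order.
The 2 in α - 1 = 2w absorbs the denominator of v(v-1)/2. -/
theorem pow_sub_one_and_geom_sub_dvd {α w : ℤ} {v : ℕ} (hα : α - 1 = 2 * w) (hw : 2 ∣ w)
    (hv : v = w.natAbs) (l : ℕ) :
    ((v ^ l : ℕ) : ℤ) * (2 * w) ∣ α ^ (v ^ l) - 1 ∧
      ((v ^ l : ℕ) : ℤ) * w ∣ geom α (v ^ l) - (v ^ l : ℕ) := by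
  obtain ⟨z, hz⟩ := hw
  -- The sign e of w is kept as a unit, which treats both signs at once.
  obtain ⟨e, he1, he2⟩ : ∃ e : ℤ, (v : ℤ) = e * w ∧ e * e = 1 := by
    rcases Int.natAbs_eq w with h | h
    · exact ⟨1, by rw [hv]; linarith, by norm_num⟩
    · exact ⟨-1, by rw [hv]; linarith, by norm_num⟩
  have quad : ∀ (x : ℤ) (n : ℕ), ∃ q,
      2 * geom (1 + x) n = 2 * n + x * (n * (n - 1)) + x * x * q := by
    intro x n
    induction n with
    | zero => exact ⟨0, by simp [geom_zero]⟩
    | succ n ih =>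
      obtain ⟨q, hq⟩ := ih
      refine ⟨q + x * q + n * (n - 1), ?_⟩
      rw [geom_succ]
      push_cast
      linear_combination (1 + x) * hq
  have main : ((v ^ l : ℕ) : ℤ) * w ∣ geom α (v ^ l) - (v ^ l : ℕ) := by
    induction l with
    | zero => simp [geom]
    | succ l ih =>
      generalize hn : v ^ l = n at ih
      obtain ⟨t, ht⟩ := ih
      have hk : geom α n = n * (1 + w * t) := by linear_combination ht
      have hpow : α ^ n = 1 + 2 * w * n * (1 + w * t) := by
        have := geom_mul α n
        rw [hk, hα] at this
        linear_combination -this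
      obtain ⟨q, hq⟩ := quad (2 * w * n * (1 + w * t)) v
      have hg : geom (α ^ n) v = v * (1 + w * (n * (1 + w * t) * (v - 1)
          + 2 * e * n * n * (1 + w * t) * (1 + w * t) * q)) := by
        rw [hpow]
        have h2 : (2 : ℤ) ≠ 0 := two_ne_zero
        apply mul_left_cancel₀ h2
        rw [hq]
        rw [he1]
        linear_combination (-4 * w * w * n * n * (1 + w * t) * (1 + w * t) * q) * he2
      rw [pow_succ', hn, geom_mul_index, hk, hg]
      push_cast
      refine ⟨t + (n * (1 + w * t) * (v - 1)
          + 2 * e * n * n * (1 + w * t) * (1 + w * t) * q) * (1 + w * t), ?_⟩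
      ring
  refine ⟨?_, main⟩
  rw [← geom_mul, hα]
  refine mul_dvd_mul ?_ dvd_rfl
  have := (dvd_mul_right _ _).trans main
  exact (dvd_sub_left dvd_rfl).1 this

namespace MacPair

variable {T : Type*} [Group T] {α : ℤ} {a b : T}

theorem comm_pow_comm (h : MacPair α a b) (n : ℕ) :
    comm (a ^ n) b = comm a b ^ n * a ^ (-defect α n) := by
  have h1 : comm (a ^ n) b = (a ^ n)⁻¹ * (b⁻¹ * (a ^ n * b)) := by simp [comm, mul_assoc]
  have h2 := h.zpow_mul_comm_pow (-n) n
  rw [zpow_neg, zpow_natCast] at h2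
  rw [h1, h.pow_mul_right, inv_mul_cancel_left, ← mul_assoc, h2, mul_assoc, ← zpow_add, defect]
  congr 2; ring

theorem comm_comm_pow_left (h : MacPair α a b) (n : ℕ) :
    comm (comm a b ^ n) a = a ^ (1 - α ^ n) := by
  have h2 := h.zpow_mul_comm_pow (-1) n
  rw [zpow_neg_one] at h2
  rw [comm, mul_assoc _ a⁻¹, h2, inv_mul_cancel_left, ← zpow_add_one]
  congr 1; ring

/-- Conjugation by c is injective on powers of a, whereas raising to a multiple of p would kill the
nontrivial element a^(|a|/p). -/
theorem isUnit_of_dvd (h : MacPair α a b) {p : ℕ} (hp : p.Prime) (hpN : p ∣ orderOf a)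
    (h0 : orderOf a ≠ 0) : ¬ (p : ℤ) ∣ α := by
  rintro ⟨r, hr⟩
  obtain ⟨e, he⟩ := hpN
  have h1 := h.zpow_mul_comm e
  have h2 : a ^ (α * e) = 1 := by
    rw [hr, show (p : ℤ) * r * e = ((p * e : ℕ) : ℤ) * r by push_cast; ring, ← he, zpow_mul,
      zpow_natCast, pow_orderOf_eq_one, one_zpow]
  rw [h2, mul_one, zpow_natCast] at h1
  have h3 : a ^ e = 1 := mul_eq_right.1 h1
  have h4 := orderOf_dvd_of_pow_eq_one h3
  have he0 : 0 < e := Nat.pos_of_ne_zero (by rintro rfl; rw [mul_zero] at he; exact h0 he)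
  have := Nat.le_of_dvd he0 h4
  rw [he] at this
  nlinarith [hp.one_lt]

theorem orderOf_ne_zero (h : MacPair α a b) (h1 : ¬ IsUnit α) : orderOf a ≠ 0 := by
  -- The square gives a natural number even for negative α, and n = α² holds exactly, so the defect
  -- identities apply before any order is known to be finite.
  set n := α.natAbs ^ 2 with hn
  have hn2 : ((n : ℕ) : ℤ) = α ^ 2 := by rw [hn, Nat.cast_pow, Int.natAbs_sq]
  have hpow : ∀ x : T, x ^ n = x ^ α ^ 2 := fun x => by rw [← hn2, zpow_natCast]
  have h2 := h.left_zpow_defect_mul (hpow a) (hpow b)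
  rw [defect_mul, hn2] at h2
  intro h0
  by_cases hα : α = 0
  · have := h.left
    rw [hα, zpow_zero] at this
    have h3 : a = 1 := by
      have : (comm a b)⁻¹ * a * comm a b = 1 := this
      rw [mul_assoc, inv_mul_eq_one] at this
      exact (mul_eq_right.1 this.symm)
    rw [h3, orderOf_one] at h0
    exact one_ne_zero h0
  · apply (isOfFinOrder_iff_zpow_eq_one.2 ⟨_, ?_, h2⟩).orderOf_pos.ne' h0
    intro h4
    have hn0 : n ≠ 0 := by simp [hn, hα]
    obtain ⟨k, hk⟩ := Nat.exists_eq_succ_of_ne_zero hn0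
    have h5 : α * (α ^ n * (α * (α - 1) - 1) + 1) = 0 := by linear_combination h4
    rcases mul_eq_zero.1 h5 with h6 | h6
    · exact hα h6
    · apply h1
      rw [hk, pow_succ] at h6
      exact IsUnit.of_mul_eq_one (-(α ^ k * (α * (α - 1) - 1))) (by linear_combination -h6)

/-- A common exponent of `a` and `b` all of whose prime factors divide `α - 1`. -/
theorem exists_exponent (h : MacPair α a b) (h1 : ¬ IsUnit α) :
    ∃ N : ℕ, 0 < N ∧ a ^ N = 1 ∧ b ^ N = 1 ∧ IsCoprime (N : ℤ) α ∧
      ∀ p : ℕ, p.Prime → p ∣ N → (p : ℤ) ∣ α - 1 := by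
  have ha := h.orderOf_ne_zero h1
  have hb := h.swap.orderOf_ne_zero h1
  set N := Nat.lcm (orderOf a) (orderOf b) with hN
  have hN0 : 0 < N := Nat.lcm_pos (Nat.pos_of_ne_zero ha) (Nat.pos_of_ne_zero hb)
  have haN : a ^ N = 1 := orderOf_dvd_iff_pow_eq_one.1 (Nat.dvd_lcm_left _ _)
  have hbN : b ^ N = 1 := orderOf_dvd_iff_pow_eq_one.1 (Nat.dvd_lcm_right _ _)
  have hcop : IsCoprime (N : ℤ) α := by
    rw [Int.isCoprime_iff_gcd_eq_one, ← Int.natAbs_natCast N]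
    apply Nat.Coprime.symm
    refine Nat.coprime_of_dvd fun p hp hpα hpN => ?_
    rw [Int.natAbs_natCast] at hpN
    have hpα' : (p : ℤ) ∣ α := Int.natCast_dvd.2 hpα
    rcases (hp.prime.dvd_lcm).1 hpN with h2 | h2
    · exact h.isUnit_of_dvd hp h2 ha hpα'
    · exact h.swap.isUnit_of_dvd hp h2 hb hpα'
  refine ⟨N, hN0, haN, hbN, hcop, prime_dvd_sub_one hN0 hcop fun n i hni => ?_⟩
  have hpow : ∀ x : T, x ^ N = 1 → x ^ n = x ^ α ^ i := fun x hx => by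
    obtain ⟨t, ht⟩ := Int.modEq_iff_dvd.1 hni
    rw [← zpow_natCast, show α ^ i = n + N * t by linear_combination ht, zpow_add, zpow_mul,
      zpow_natCast x N, hx, one_zpow, mul_one]
  have h2 := h.left_zpow_defect_mul (hpow a haN) (hpow b hbN)
  have h3 := h.right_zpow_defect_mul (hpow a haN) (hpow b hbN)
  rw [← orderOf_dvd_iff_zpow_eq_one] at h2 h3
  rw [hN]
  exact Int.natCast_dvd.2 (Nat.lcm_dvd (Int.natCast_dvd.1 h2) (Int.natCast_dvd.1 h3))

end MacPair

theorem exists_pow_eq_zpow {T : Type*} [Group T] {x : T} {N : ℕ} (hN : 0 < N) (hx : x ^ N = 1)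
    (z : ℤ) : ∃ n : ℕ, x ^ z = x ^ n := by
  refine ⟨(z % N).toNat, ?_⟩
  rw [← zpow_natCast, Int.toNat_of_nonneg (Int.emod_nonneg _ (by positivity))]
  conv_lhs => rw [← Int.emod_add_mul_ediv z N, zpow_add, zpow_mul, zpow_natCast x N, hx, one_zpow,
    mul_one]

theorem comm_pow_self {T : Type*} [Group T] (x : T) (n : ℕ) : comm (x ^ n) x = 1 := by
  rw [comm]; group

namespace MacPair

variable {T : Type*} [Group T] {α : ℤ} {a b : T}

theorem comm_mem (h : MacPair α a b) {N : Subgroup T} [N.Normal] {n : ℕ}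
    (hb : b ^ (1 - α ^ n) ∈ N) : comm (comm a b ^ n) b ∈ N := by
  have h1 := h.comm_pow_mul_zpow 1 n
  rw [zpow_one, mul_one] at h1
  have h2 : comm (comm a b ^ n) b
      = (comm a b ^ n)⁻¹ * (b ^ (1 - α ^ n))⁻¹ * ((comm a b ^ n)⁻¹)⁻¹ := by
    rw [comm, mul_assoc _ (comm a b ^ n), h1, ← zpow_neg, neg_sub, sub_eq_add_neg, add_comm,
      zpow_add]
    group
  rw [h2]
  exact Subgroup.Normal.conj_mem inferInstance _ (inv_mem hb) _

/-- Put v = |w| and n = v^l; the common exponent N divides some power of v. If a^(nv) and b^(nv) lie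
in Z_k, then [c^n, a] = a^(1-α^n) and its analogue for b put c^n in Z_(k+1), and [a^n, b] = c^n
a^(-defect) puts a^n, b^n in Z_(k+2), as the exponents are divisible by nw. Descending to l = 0 puts
a and b themselves in some Z_k. -/
theorem isNilpotent (h : MacPair α a b) (hgen : Subgroup.closure {a, b} = ⊤)
    (h1 : ¬ IsUnit α) {w : ℤ} (hα : α - 1 = 2 * w) (hw : 2 ∣ w) : Group.IsNilpotent T := by
  obtain ⟨N, hN, haN, hbN, -, hp⟩ := h.exists_exponent h1
  set v := w.natAbs with hv
  obtain ⟨L, hL⟩ : ∃ l, N ∣ v ^ l := by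
    refine exists_dvd_pow hN.ne' fun p hpp hpN => ?_
    have h2 := hp p hpp hpN
    rw [hα, Int.natCast_dvd, Int.natAbs_mul] at h2
    rcases hpp.dvd_mul.1 h2 with h3 | h3
    · exact h3.trans (by simpa using Int.natAbs_dvd_natAbs.2 hw)
    · exact h3
  have step : ∀ l, (∃ k, a ^ v ^ (l + 1) ∈ Subgroup.upperCentralSeries T k ∧
      b ^ v ^ (l + 1) ∈ Subgroup.upperCentralSeries T k) →
      ∃ k, a ^ v ^ l ∈ Subgroup.upperCentralSeries T k ∧
        b ^ v ^ l ∈ Subgroup.upperCentralSeries T k := by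
    rintro l ⟨k, hak, hbk⟩
    obtain ⟨hd1, hd2⟩ := pow_sub_one_and_geom_sub_dvd hα hw hv l
    rw [pow_succ] at hak hbk
    set n := v ^ l
    have hmem : ∀ x : T, x ^ (n * v) ∈ Subgroup.upperCentralSeries T k →
        ∀ z : ℤ, (n : ℤ) * w ∣ z → x ^ z ∈ Subgroup.upperCentralSeries T k := by
      intro x hx z hz
      have h2 : ((n * v : ℕ) : ℤ) ∣ z := by
        rw [Nat.cast_mul, hv]
        exact (mul_dvd_mul_left _ (Int.natAbs_dvd.2 dvd_rfl)).trans hz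
      obtain ⟨t, rfl⟩ := h2
      rw [zpow_mul, zpow_natCast]
      exact zpow_mem hx t
    have hd3 : (n : ℤ) * w ∣ 1 - α ^ n := by
      refine (dvd_sub_comm).1 ((Dvd.intro_left 2 ?_).trans hd1)
      ring
    have hd4 : (n : ℤ) * w ∣ -defect α n := by
      obtain ⟨x, hx⟩ := hd3
      obtain ⟨y, hy⟩ := hd2
      refine ⟨n * x + 2 + 2 * w * y + y, ?_⟩
      unfold defect
      linear_combination n * hx + (α * hy) + (n + n * w * y) * hα
    have hc : comm a b ^ n ∈ Subgroup.upperCentralSeries T (k + 1) := by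
      refine mem_upperCentralSeries_succ hgen fun y hy => ?_
      rcases hy with rfl | rfl
      · rw [h.comm_comm_pow_left]
        exact hmem _ hak _ hd3
      · exact h.comm_mem (hmem _ hbk _ hd3)
    have hmono := Subgroup.upperCentralSeries_mono T (Nat.le_succ k)
    refine ⟨k + 2, mem_upperCentralSeries_succ hgen fun y hy => ?_,
      mem_upperCentralSeries_succ hgen fun y hy => ?_⟩
    · rcases hy with rfl | rfl
      · rw [comm_pow_self]; exact one_mem _
      · rw [h.comm_pow_comm]
        exact mul_mem hc (hmono (hmem _ hak _ hd4))
    · rcases hy with rfl | rfl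
      · rw [h.swap.comm_pow_comm, comm_swap y b, inv_pow]
        exact mul_mem (inv_mem hc) (hmono (hmem _ hbk _ hd4))
      · rw [comm_pow_self]; exact one_mem _
  have descend : ∀ l, (∃ k, a ^ v ^ l ∈ Subgroup.upperCentralSeries T k ∧
      b ^ v ^ l ∈ Subgroup.upperCentralSeries T k) →
      ∃ k, a ∈ Subgroup.upperCentralSeries T k ∧ b ∈ Subgroup.upperCentralSeries T k := by
    intro l
    induction l with
    | zero => simp
    | succ l ih => exact fun H => ih (step l H)
  obtain ⟨k, hak, hbk⟩ := descend L ⟨0, by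
    obtain ⟨t, ht⟩ := hL
    rw [ht, pow_mul, pow_mul, haN, hbN, one_pow]
    exact ⟨one_mem _, one_mem _⟩⟩
  refine ⟨k, top_le_iff.1 (hgen ▸ (Subgroup.closure_le _).2 ?_)⟩
  rintro y (rfl | rfl)
  · exact hak
  · exact hbk

/-! ### Normal form a^i c^k b^j and finiteness. -/

theorem comm_pow_mul_zpow_left (h : MacPair α a b) {β : ℤ} (hβ : a ^ (α * β) = a) (k : ℕ) (z : ℤ) :
    comm a b ^ k * a ^ z = a ^ (β ^ k * z) * comm a b ^ k := by
  have h1 : ∀ z : ℤ, comm a b * a ^ z = a ^ (β * z) * comm a b := by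
    intro z
    rw [h.zpow_mul_comm, ← mul_assoc, zpow_mul, hβ]
  induction k generalizing z with
  | zero => simp
  | succ k ih =>
    rw [pow_succ, mul_assoc, h1, ← mul_assoc, ih, mul_assoc]
    congr 2; ring

theorem zpow_mul_comm_pow_right (h : MacPair α a b) {β : ℤ} (hβ : b ^ (α * β) = b) (k : ℕ) (z : ℤ) :
    b ^ z * comm a b ^ k = comm a b ^ k * b ^ (β ^ k * z) := by
  have h1 := h.swap.comm_pow_mul_zpow_left hβ k z
  rw [comm_swap a b, inv_pow, inv_mul_eq_iff_eq_mul] at h1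
  rw [h1]; group

/-- When a^N = 1, `pow_mul_right` shows that c^N is a power of a, so its N-th power is trivial. -/
theorem comm_pow_eq_one (h : MacPair α a b) {N : ℕ} (ha : a ^ N = 1) :
    comm a b ^ (N * N) = 1 := by
  have h1 := h.pow_mul_right N
  rw [ha, one_mul] at h1
  have h2 := mul_eq_left.1 h1.symm
  rw [pow_mul, eq_inv_of_mul_eq_one_left h2, ← zpow_neg, ← zpow_natCast, ← zpow_mul, mul_comm,
    zpow_mul, zpow_natCast, ha, one_zpow]

theorem mul_left_normalForm (h : MacPair α a b) {β : ℤ} (hβ : a ^ (α * β) = a) (i k j : ℕ) :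
    a ^ i * comm a b ^ k * b ^ j * a
      = a ^ (i + β ^ k) * comm a b ^ (k - j : ℤ) * b ^ (α * geom α j) := by
  have h1 := h.comm_pow_mul_zpow_left hβ k 1
  rw [zpow_one, mul_one] at h1
  rw [mul_assoc, h.pow_mul_left, mul_assoc (a ^ i), ← mul_assoc (comm a b ^ k), h1, zpow_add,
    zpow_sub]
  simp only [zpow_natCast, mul_assoc]

/-- The products a^i c^k b^j are stable under right multiplication by a and b, and torsion makes
inverses of generators into powers. Here β is an inverse of α modulo N, needed to move a leftwards
past c^k. -/
theorem exists_normalForm (h : MacPair α a b) (hgen : Subgroup.closure {a, b} = ⊤) {N : ℕ}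
    (hN : 0 < N) (ha : a ^ N = 1) (hb : b ^ N = 1) (hcop : IsCoprime (N : ℤ) α) (x : T) :
    ∃ i k j : ℕ, x = a ^ i * comm a b ^ k * b ^ j := by
  obtain ⟨r, β, hβ⟩ := hcop
  have hβ' : a ^ (α * β) = a := by
    rw [show α * β = 1 - N * r by linear_combination hβ, zpow_sub, zpow_mul, zpow_natCast a N, ha]
    simp
  have hc := h.comm_pow_eq_one ha
  have hmulb : ∀ y : T, (∃ i k j : ℕ, y = a ^ i * comm a b ^ k * b ^ j) →
      ∃ i k j : ℕ, y * b = a ^ i * comm a b ^ k * b ^ j := by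
    rintro y ⟨i, k, j, rfl⟩
    exact ⟨i, k, j + 1, by rw [pow_succ, mul_assoc]⟩
  have hmula : ∀ y : T, (∃ i k j : ℕ, y = a ^ i * comm a b ^ k * b ^ j) →
      ∃ i k j : ℕ, y * a = a ^ i * comm a b ^ k * b ^ j := by
    rintro y ⟨i, k, j, rfl⟩
    rw [h.mul_left_normalForm hβ']
    obtain ⟨i', hi⟩ := exists_pow_eq_zpow hN ha (i + β ^ k)
    obtain ⟨k', hk⟩ := exists_pow_eq_zpow (Nat.mul_pos hN hN) hc (k - j)
    obtain ⟨j', hj⟩ := exists_pow_eq_zpow hN hb (α * geom α j)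
    exact ⟨i', k', j', by rw [hi, hk, hj]⟩
  have hpow : ∀ s : T, (∀ y : T, (∃ i k j : ℕ, y = a ^ i * comm a b ^ k * b ^ j) →
      ∃ i k j : ℕ, y * s = a ^ i * comm a b ^ k * b ^ j) → ∀ (n : ℕ) (y : T),
      (∃ i k j : ℕ, y = a ^ i * comm a b ^ k * b ^ j) →
      ∃ i k j : ℕ, y * s ^ n = a ^ i * comm a b ^ k * b ^ j := by
    intro s hs n
    induction n with
    | zero => simp
    | succ n ih =>
      intro y hy
      rw [pow_succ, ← mul_assoc]
      exact hs _ (ih y hy)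
  have hinv : ∀ s : T, s ^ N = 1 → s⁻¹ = s ^ (N - 1) := by
    intro s hs
    rw [inv_eq_iff_mul_eq_one, ← pow_succ', Nat.sub_add_cancel hN, hs]
  have hx : x ∈ Subgroup.closure {a, b} := hgen ▸ Subgroup.mem_top x
  induction hx using Subgroup.closure_induction_right with
  | one => exact ⟨0, 0, 0, by simp⟩
  | mul_right x _ y hy ih =>
    rcases hy with rfl | rfl
    · exact hmula _ ih
    · exact hmulb _ ih
  | mul_inv_cancel x _ y hy ih =>
    rcases hy with rfl | rfl
    · rw [hinv _ ha]; exact hpow _ hmula _ _ ih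
    · rw [hinv _ hb]; exact hpow _ hmulb _ _ ih

theorem finite (h : MacPair α a b) (hgen : Subgroup.closure {a, b} = ⊤) (h1 : ¬ IsUnit α) :
    Finite T := by
  obtain ⟨N, hN, ha, hb, hcop, -⟩ := h.exists_exponent h1
  have hc := h.comm_pow_eq_one ha
  have hf : ∀ x : T, ∀ M : ℕ, 0 < M → x ^ M = 1 → Finite (Subgroup.zpowers x) :=
    fun x M hM hx => (finite_zpowers.2 (isOfFinOrder_iff_pow_eq_one.2 ⟨M, hM, hx⟩)).to_subtype
  have := hf a N hN ha
  have := hf b N hN hb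
  have := hf _ _ (Nat.mul_pos hN hN) hc
  refine Finite.of_surjective (fun p : Subgroup.zpowers a × Subgroup.zpowers (comm a b) ×
    Subgroup.zpowers b => (p.1 * p.2.1 * p.2.2 : T)) fun x => ?_
  obtain ⟨i, k, j, rfl⟩ := h.exists_normalForm hgen hN ha hb hcop x
  exact ⟨⟨⟨_, Subgroup.npow_mem_zpowers a i⟩, ⟨_, Subgroup.npow_mem_zpowers _ k⟩,
    ⟨_, Subgroup.npow_mem_zpowers b j⟩⟩, rfl⟩

end MacPair

/-! ### A permutation model giving the lower bound 16h^7. -/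

/-- The binomial coefficient `n.choose 2` for an integer `n`. -/
def tri (n : ℤ) : ℤ := n * (n - 1) / 2

/-- The binomial coefficient `n.choose 3` for an integer `n`. -/
def tet (n : ℤ) : ℤ := n * (n - 1) * (n - 2) / 6

theorem two_mul_tri (n : ℤ) : 2 * tri n = n * (n - 1) :=
  Int.mul_ediv_cancel' (Int.even_mul_pred_self n).two_dvd

theorem six_mul_tet (n : ℤ) : 6 * tet n = n * (n - 1) * (n - 2) := by
  apply Int.mul_ediv_cancel'
  have h2 : (2 : ℤ) ∣ n * (n - 1) * (n - 2) := (Int.even_mul_pred_self n).two_dvd.mul_right _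
  have h3 : (3 : ℤ) ∣ n * (n - 1) * (n - 2) := by
    have : n % 3 = 0 ∨ n % 3 = 1 ∨ n % 3 = 2 := by omega
    rcases this with h | h | h
    · exact ((Int.dvd_of_emod_eq_zero h).mul_right _).mul_right _
    · exact ((show (3 : ℤ) ∣ n - 1 by omega).mul_left _).mul_right _
    · exact (show (3 : ℤ) ∣ n - 2 by omega).mul_left _
  exact IsCoprime.mul_dvd (x := 2) (y := 3) ⟨-1, 1, by norm_num⟩ h2 h3

theorem cast_tri (n : ℤ) : ((tri n : ℤ) : ℚ) = n * (n - 1) / 2 := by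
  have : ((2 * tri n : ℤ) : ℚ) = n * (n - 1) := by rw [two_mul_tri]; push_cast; ring
  push_cast at this
  linarith

theorem cast_tet (n : ℤ) : ((tet n : ℤ) : ℚ) = n * (n - 1) * (n - 2) / 6 := by
  have : ((6 * tet n : ℤ) : ℚ) = n * (n - 1) * (n - 2) := by rw [six_mul_tet]; push_cast; ring
  push_cast at this
  linarith

theorem tri_add (h x z : ℤ) : tri (x + 2 * h * z) = tri x + h * (z * (2 * x + 2 * h * z - 1)) := by
  rw [← Int.cast_inj (α := ℚ)]
  push_cast [cast_tri]
  ring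

/-- The increment is h times an integer over 3, and h is prime to 3. -/
theorem exists_tet_add {h : ℤ} (h3 : IsCoprime h 3) (x z : ℤ) :
    ∃ q, tet (x + 2 * h * z) = tet x + h * q := by
  have : h ∣ 3 * (tet (x + 2 * h * z) - tet x) := by
    refine ⟨z * (3 * x ^ 2 + 6 * x * h * z + 4 * h ^ 2 * z ^ 2 - 6 * x - 6 * h * z + 2), ?_⟩
    rw [← Int.cast_inj (α := ℚ)]
    push_cast [cast_tet]
    ring
  obtain ⟨q, hq⟩ := h3.dvd_of_dvd_mul_left this
  exact ⟨q, by linear_combination hq⟩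

/-- The underlying set of the model of the Sylow subgroup; the class `lat (i, k, j)` stands for
the element `a ^ i * c ^ k * b ^ j`. -/
abbrev Model (h : ℕ) : Type :=
  ZMod (4 * h ^ 3) × ZMod (2 * h ^ 2) × ZMod (2 * h ^ 2)

/-- The class of a triple of exponents. -/
def lat (h : ℕ) (p : ℤ × ℤ × ℤ) : Model h :=
  (((p.1 - p.2.2 + h * p.2.1 : ℤ) : ZMod (4 * h ^ 3)), (p.2.1 : ZMod (2 * h ^ 2)),
    (p.2.2 : ZMod (2 * h ^ 2)))

theorem lat_surjective (h : ℕ) : Function.Surjective (lat h) := by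
  rintro ⟨x, y, z⟩
  obtain ⟨x, rfl⟩ := ZMod.intCast_surjective x
  obtain ⟨y, rfl⟩ := ZMod.intCast_surjective y
  obtain ⟨z, rfl⟩ := ZMod.intCast_surjective z
  refine ⟨(x + z - h * y, y, z), ?_⟩
  simp only [lat, Prod.mk.injEq, and_true]
  congr 1; ring

/-- The parameters x, y, z count uses of the relations a^(4h³) = 1, c^(2h²) = a^(2h³) and a^(2h²)
b^(2h²) = 1. -/
theorem lat_eq_iff {h : ℕ} {i k j i' k' j' : ℤ} : lat h (i, k, j) = lat h (i', k', j') ↔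
    ∃ x y z : ℤ, i = i' + 4 * h ^ 3 * x + 2 * h ^ 2 * z - 2 * h ^ 3 * y ∧
      k = k' + 2 * h ^ 2 * y ∧ j = j' + 2 * h ^ 2 * z := by
  simp only [lat, Prod.mk.injEq, ZMod.intCast_eq_intCast_iff_dvd_sub]
  push_cast
  constructor
  · rintro ⟨⟨x, hx⟩, ⟨y, hy⟩, ⟨z, hz⟩⟩
    exact ⟨-x, -y, -z, by linear_combination -hx - hz + h * hy, by linear_combination -hy,
      by linear_combination -hz⟩
  · rintro ⟨x, y, z, h1, h2, h3⟩
    exact ⟨⟨-x, by linear_combination -h1 + h3 - h * h2⟩,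
      ⟨-y, by linear_combination -h2⟩, ⟨-z, by linear_combination -h3⟩⟩

section

variable (h : ℕ) (v : ℤ)

/-- The exponents of `a ^ i * c ^ k * b ^ j * a`. -/
def stepA (p : ℤ × ℤ × ℤ) : ℤ × ℤ × ℤ :=
  (p.1 + 1 - 2 * h * v * p.2.1 + 4 * h ^ 2 * v ^ 2 * (tri (p.2.1 + 1) - tet (p.2.2 + 1)),
    p.2.1 - p.2.2, p.2.2 + 2 * h * v * tri (p.2.2 + 1))

/-- The exponents of `a ^ i * c ^ k * b ^ j * b`. -/
def stepB (p : ℤ × ℤ × ℤ) : ℤ × ℤ × ℤ := (p.1, p.2.1, p.2.2 + 1)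

/-- The exponents of `a ^ i * c ^ k * b ^ j * c`. -/
def stepC (p : ℤ × ℤ × ℤ) : ℤ × ℤ × ℤ :=
  (p.1 - 4 * h ^ 2 * v ^ 2 * p.2.2, p.2.1 + 1, p.2.2 - 2 * h * v * p.2.2)

/-- The exponents of `a ^ i * c ^ k * b ^ j * a ^ n`. -/
def iterA (n : ℤ) (p : ℤ × ℤ × ℤ) : ℤ × ℤ × ℤ :=
  (p.1 + n - 2 * h * v * (n * p.2.1 - tri n * p.2.2 - 2 * h * v * tet n * tri (p.2.2 + 1))
      + 4 * h ^ 2 * v ^ 2 * (n * tri (p.2.1 + 1) - tri n * p.2.2 * p.2.1 + tet n * p.2.2 ^ 2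
        + tri n * tri p.2.2 - n * tet (p.2.2 + 1))
      - 2 * h ^ 2 * v ^ 2 * tri n * tri (p.2.2 + 1) * (2 * p.2.2 + 1),
    p.2.1 - n * p.2.2 - 2 * h * v * tri n * tri (p.2.2 + 1),
    p.2.2 + 2 * h * v * n * tri (p.2.2 + 1))

variable {h v}

theorem iterA_zero (p : ℤ × ℤ × ℤ) : iterA h v 0 p = p := by
  obtain ⟨i, k, j⟩ := p
  simp [iterA, tri, tet]

/-- Oddness of v is essential: shifting j by 2h²z leaves in the first coordinate a discrepancy
2h³z(1 + v·odd), which has to be a multiple of 4h³. -/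
theorem lat_stepA_congr (h3 : IsCoprime (h : ℤ) 3) (hv : Odd v) {p q : ℤ × ℤ × ℤ}
    (hpq : lat h p = lat h q) : lat h (stepA h v p) = lat h (stepA h v q) := by
  obtain ⟨i, k, j⟩ := p
  obtain ⟨i', k', j'⟩ := q
  obtain ⟨x, y, z, rfl, rfl, rfl⟩ := lat_eq_iff.1 hpq
  obtain ⟨w, rfl⟩ := hv
  obtain ⟨q, hq⟩ := exists_tet_add h3 (j' + 1) (h * z)
  have hy := tri_add h (k' + 1) (h * y)
  have hz := tri_add h (j' + 1) (h * z)
  have e1 : k' + 2 * h ^ 2 * y + 1 = k' + 1 + 2 * h * (h * y) := by ring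
  have e2 : j' + 2 * h ^ 2 * z + 1 = j' + 1 + 2 * h * (h * z) := by ring
  simp only [stepA]
  rw [e1, e2, hy, hz, hq]
  refine lat_eq_iff.2 ⟨x - (2 * w + 1) * y + (2 * w + 1) ^ 2 * (h * y * (2 * (k' + 1) +
    2 * h * (h * y) - 1) - q) - z - z * w - (2 * w + 1) * z * (j' + h ^ 2 * z), y - z,
    z + (2 * w + 1) * (h * z * (2 * (j' + 1) + 2 * h * (h * z) - 1)), ?_, by ring, by ring⟩
  ring

theorem lat_stepB_congr {p q : ℤ × ℤ × ℤ} (hpq : lat h p = lat h q) :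
    lat h (stepB p) = lat h (stepB q) := by
  obtain ⟨i, k, j⟩ := p
  obtain ⟨i', k', j'⟩ := q
  obtain ⟨x, y, z, rfl, rfl, rfl⟩ := lat_eq_iff.1 hpq
  exact lat_eq_iff.2 ⟨x, y, z, by ring, by ring, by ring⟩

theorem lat_stepC_congr {p q : ℤ × ℤ × ℤ} (hpq : lat h p = lat h q) :
    lat h (stepC h v p) = lat h (stepC h v q) := by
  obtain ⟨i, k, j⟩ := p
  obtain ⟨i', k', j'⟩ := q
  obtain ⟨x, y, z, rfl, rfl, rfl⟩ := lat_eq_iff.1 hpq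
  exact lat_eq_iff.2 ⟨x - 2 * h * v ^ 2 * z + v * z, y, z - 2 * h * v * z,
    by ring, by ring, by ring⟩

/-- The recursion that makes `iterA` a closed form for iterates of `stepA` modulo the lattice; n =
-1 supplies preimages. -/
theorem lat_stepA_iterA (h3 : IsCoprime (h : ℤ) 3) (n : ℤ) (p : ℤ × ℤ × ℤ) :
    lat h (stepA h v (iterA h v n p)) = lat h (iterA h v (n + 1) p) := by
  obtain ⟨i, k, j⟩ := p
  simp only [stepA, iterA]
  set T := tri (j + 1) with hT
  obtain ⟨q, hq⟩ := exists_tet_add h3 (j + 1) (v * n * T)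
  have e1 : j + 2 * h * v * n * T + 1 = j + 1 + 2 * h * (v * n * T) := by ring
  have e2 : k - n * j - 2 * h * v * tri n * T + 1 = k - n * j + 1 + 2 * h * (-(v * tri n * T)) := by
    ring
  rw [e1, e2, hq, tri_add, tri_add, ← hT]
  refine lat_eq_iff.2 ⟨v ^ 2 * (-(v * tri n * T) * (2 * (k - n * j + 1)
    + 2 * h * (-(v * tri n * T)) - 1) - q) - v ^ 3 * n ^ 2 * T ^ 2, 0,
    v ^ 2 * n * T * (2 * j + 1) + 2 * h * v ^ 3 * n ^ 2 * T ^ 2, ?_, ?_, ?_⟩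
  -- Over ℚ both `tri` and `tet` become polynomials, so the identity is decided by `ring`.
  · rw [← Int.cast_inj (α := ℚ)]
    push_cast [cast_tri, cast_tet]
    ring
  · rw [← Int.cast_inj (α := ℚ)]
    push_cast [cast_tri, cast_tet]
    ring
  · ring

theorem lat_stepC_stepA (h2 : Even h) (h3 : IsCoprime (h : ℤ) 3) (hv : Odd v) (p : ℤ × ℤ × ℤ) :
    lat h (stepC h v (stepA h v p)) = lat h (iterA h v (1 + 2 * h * v) (stepC h v p)) := by
  obtain ⟨i, k, j⟩ := p
  obtain ⟨g, hg⟩ := h2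
  obtain ⟨w, hw⟩ := hv
  obtain ⟨s, hs⟩ := exists_tet_add h3 (j + 1) (-(v * j))
  obtain ⟨r, hr⟩ := exists_tet_add h3 1 v
  have hr' : tet (1 + 2 * h * v) = h * r := by
    rw [hr]; simp [tet]
  have e1 : j - 2 * h * v * j + 1 = j + 1 + 2 * h * (-(v * j)) := by ring
  simp only [stepA, stepC, iterA]
  rw [hr', e1, hs]
  have hg' : (h : ℤ) = 2 * g := by rw [hg]; push_cast; ring
  -- The witnesses are the lattice coordinates of the difference of the two sides; the terms in g =
  -- h/2 and w = (v-1)/2 are where the parities of h and v make them integral.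
  refine lat_eq_iff.2 ⟨v ^ 2 * ((-9)*tri (j+1)*w + (-4)*tri (j+1) + (2)*j*v + (-3)*g*j*v^2
    + (-3)*r*tri (j+1) + (1)*j*r + (12)*h*r*tri (j+1)*v + (-5)*h*j*r*v
    + (-12)*h^2*r*tri (j+1)*v^2 + (6)*h^2*j*r*v^2 + (-1)*k^2*v + (-3)*k*v + (-2)*v
    + (-4)*h^2*j*k*v^3 + (-6)*h^2*j*v^3 + (1)*j*k*v + (7)*h*tri (j+1)*v^2
    + (-2)*h^2*tri (j+1)*v^3 + (-12)*h^3*tri (j+1)*v^4 + (6)*h^3*j*v^4 + (2)*tet (j+1)*v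
    + (2)*h*s*v + (1)*s + (-4)*h*j*tri (j+1)*v^2 + (16)*h^3*j*tri (j+1)*v^4
    + (-16)*h^4*j*tri (j+1)*v^5 + (16)*h^4*tri (j+1)*v^5 + (-8)*h^4*j*v^5
    + (1)*j*tri (j+1)*v + (-1)*j + (-1)*h*tri (j+1)*v + (1)*g*j*v + (-2)*h^2*tri (j+1)*v^2
    + (4)*h^3*tri (j+1)*v^3 + (-2)*h^3*j*v^3),
    -2 * v ^ 2 * j + v ^ 2 * (1 + 2 * h * v) * tri (j + 1 + 2 * h * (-(v * j))),
    v * (-4 * v * tri (j + 1) + (1 + 2 * h * v) * (v * j * (2 * j + 1) - 2 * h * v ^ 2 * j ^ 2)),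
    ?_, ?_, ?_⟩
  · rw [← Int.cast_inj (α := ℚ)]
    push_cast [cast_tri, cast_tet]
    rw [hw]
    have hg'' : (h : ℚ) = 2 * g := by exact_mod_cast hg'
    rw [hg'']
    push_cast
    ring
  · rw [← Int.cast_inj (α := ℚ)]
    push_cast [cast_tri, cast_tet]
    ring
  · rw [← Int.cast_inj (α := ℚ)]
    push_cast [cast_tri, cast_tet]
    ring

end

theorem map_comm {S T : Type*} [Group S] [Group T] (f : S →* T) (x y : S) :
    f (comm x y) = comm (f x) (f y) := by
  simp [comm]

theorem map_conj {S T : Type*} [Group S] [Group T] (f : S →* T) (x y : S) :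
    f (conj x y) = conj (f x) (f y) := by
  simp [conj]

theorem MacPair.exists_hom {T : Type*} [Group T] {α : ℤ} {a b : T} (h : MacPair α a b) :
    ∃ f : MacdonaldGroup α →* T, f (PresentedGroup.of 0) = a ∧ f (PresentedGroup.of 1) = b := by
  have hF : ∀ r ∈ macdonaldRels α, FreeGroup.lift ![a, b] r = 1 := by
    rintro r (rfl | rfl)
    · rw [map_mul, map_conj, map_comm, map_inv, map_zpow, mul_inv_eq_one]
      simpa using h.left
    · rw [map_mul, map_conj, map_comm, map_inv, map_zpow, mul_inv_eq_one]
      simpa using h.right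
  exact ⟨PresentedGroup.toGroup hF, PresentedGroup.toGroup.of hF, PresentedGroup.toGroup.of hF⟩

theorem macPair_of (α : ℤ) : MacPair α (PresentedGroup.of 0 : MacdonaldGroup α)
    (PresentedGroup.of 1 : MacdonaldGroup α) := by
  constructor
  · have := (PresentedGroup.mk_eq_one_iff (rels := macdonaldRels α)).2
      (Subgroup.subset_normalClosure (Or.inl rfl))
    rw [map_mul, map_conj, map_comm, map_inv, map_zpow, mul_inv_eq_one] at this
    exact this
  · have := (PresentedGroup.mk_eq_one_iff (rels := macdonaldRels α)).2
      (Subgroup.subset_normalClosure (Or.inr rfl))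
    rw [map_mul, map_conj, map_comm, map_inv, map_zpow, mul_inv_eq_one] at this
    exact this

theorem closure_of (α : ℤ) : Subgroup.closure {(PresentedGroup.of 0 : MacdonaldGroup α),
    (PresentedGroup.of 1 : MacdonaldGroup α)} = ⊤ := by
  rw [← PresentedGroup.closure_range_of]
  congr 1
  ext x
  simp [Fin.exists_fin_two, eq_comm]

theorem card_model (h : ℕ) : Nat.card (Model h) = 16 * h ^ 7 := by
  simp only [Model, Nat.card_prod, Nat.card_zmod]
  ring

section

variable {h : ℕ} {v : ℤ} {f : ℤ × ℤ × ℤ → ℤ × ℤ × ℤ}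

/-- The self-map of the model induced by a self-map of the exponents. -/
noncomputable def onModel (h : ℕ) (f : ℤ × ℤ × ℤ → ℤ × ℤ × ℤ) (x : Model h) : Model h :=
  lat h (f (Function.surjInv (lat_surjective h) x))

theorem onModel_lat (hf : ∀ p q, lat h p = lat h q → lat h (f p) = lat h (f q)) (p : ℤ × ℤ × ℤ) :
    onModel h f (lat h p) = lat h (f p) :=
  hf _ _ (Function.surjInv_eq _ _)

theorem onModel_bijective [NeZero h] (hf : ∀ p q, lat h p = lat h q → lat h (f p) = lat h (f q))
    (hs : ∀ p, ∃ q, lat h (f q) = lat h p) : Function.Bijective (onModel h f) := by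
  have : NeZero (4 * h ^ 3) := ⟨by simp [NeZero.ne h]⟩
  have : NeZero (2 * h ^ 2) := ⟨by simp [NeZero.ne h]⟩
  apply Function.Surjective.bijective_of_finite
  intro x
  obtain ⟨p, rfl⟩ := lat_surjective h x
  obtain ⟨q, hq⟩ := hs p
  exact ⟨lat h q, (onModel_lat hf q).trans hq⟩

/-- There are permutations of the model that act as `stepA`, `stepB`, `stepC` prescribe. -/
theorem exists_model_perms (h0 : h ≠ 0) (h3 : IsCoprime (h : ℤ) 3) (hv : Odd v) :
    ∃ A B C : Equiv.Perm (Model h),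
      (∀ (n : ℤ) (p), (A ^ n) (lat h p) = lat h (iterA h v n p)) ∧
      (∀ p, B (lat h p) = lat h (stepB p)) ∧ (∀ p, C (lat h p) = lat h (stepC h v p)) := by
  have : NeZero h := ⟨h0⟩
  have hA := fun p q => lat_stepA_congr (p := p) (q := q) h3 hv
  have hB := fun p q => lat_stepB_congr (h := h) (p := p) (q := q)
  have hC := fun p q => lat_stepC_congr (h := h) (v := v) (p := p) (q := q)
  let A := Equiv.ofBijective _ (onModel_bijective hA fun p =>
    ⟨iterA h v (-1) p, by rw [lat_stepA_iterA h3]; simp [iterA_zero]⟩)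
  let B := Equiv.ofBijective _ (onModel_bijective hB fun p =>
    ⟨(p.1, p.2.1, p.2.2 - 1), by simp [stepB]⟩)
  let C := Equiv.ofBijective _ (onModel_bijective hC fun p =>
    ⟨(p.1, p.2.1 - 1, p.2.2 * (1 + 2 * h * v)), by
      obtain ⟨i, k, j⟩ := p
      exact lat_eq_iff.2 ⟨-(2 * v ^ 3 * j), 0, -2 * v ^ 2 * j, by ring, by ring, by ring⟩⟩)
  have hA' : ∀ p, A (lat h p) = lat h (stepA h v p) := onModel_lat hA
  refine ⟨A, B, C, fun n => ?_, onModel_lat hB, onModel_lat hC⟩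
  induction n using Int.induction_on with
  | zero => simp [iterA_zero]
  | succ n ih =>
    intro p
    rw [add_comm, zpow_add, zpow_one, Equiv.Perm.mul_apply, ih, hA', lat_stepA_iterA h3, add_comm]
  | pred n ih =>
    intro p
    have h1 := ih p
    have h4 := lat_stepA_iterA (v := v) h3 (-n - 1) p
    rw [sub_add_cancel, ← hA', ← h1] at h4
    rw [sub_eq_add_neg, add_comm, zpow_add, Equiv.Perm.mul_apply, zpow_neg_one,
      Equiv.Perm.inv_eq_iff_eq, add_comm, ← sub_eq_add_neg]
    exact h4.symm

open MulOpposite in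
-- The permutations imitate right multiplication, which reverses products, hence the opposite group.
-- There the identities `r1`, `r2`, `r3` read ab = bac, ac = ca^α and cb = b^α c.
theorem macPair_perms {A B C : Equiv.Perm (Model h)} (h2 : Even h) (h3 : IsCoprime (h : ℤ) 3)
    (hv : Odd v) (hA : ∀ (n : ℤ) (p), (A ^ n) (lat h p) = lat h (iterA h v n p))
    (hB : ∀ p, B (lat h p) = lat h (stepB p)) (hC : ∀ p, C (lat h p) = lat h (stepC h v p)) :
    MacPair (1 + 2 * h * v) (op A) (op B) ∧ comm (op A) (op B) = op C := by
  have ext : ∀ f g : Equiv.Perm (Model h), (∀ p, f (lat h p) = g (lat h p)) → f = g := by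
    intro f g hfg
    ext1 x
    obtain ⟨p, rfl⟩ := lat_surjective h x
    exact hfg p
  have hA1 : ∀ p, A (lat h p) = lat h (stepA h v p) := by
    intro p
    have h1 := hA 1 p
    have h4 := lat_stepA_iterA (v := v) h3 0 p
    rw [iterA_zero, zero_add] at h4
    rw [zpow_one] at h1
    rw [h1, h4]
  have hBpow : ∀ (n : ℤ) (p : ℤ × ℤ × ℤ), (B ^ n) (lat h p) = lat h (p.1, p.2.1, p.2.2 + n) := by
    intro n
    induction n using Int.induction_on with
    | zero => simp
    | succ n ih =>
      intro p
      rw [add_comm, zpow_add, zpow_one, Equiv.Perm.mul_apply, ih, hB, stepB, add_assoc,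
        add_comm (n : ℤ)]
    | pred n ih =>
      intro p
      rw [sub_eq_add_neg, add_comm, zpow_add, Equiv.Perm.mul_apply, zpow_neg_one,
        Equiv.Perm.inv_eq_iff_eq, ih, hB, stepB]
      simp only
      congr 3; ring
  have r1 : B * A = C * (A * B) := by
    refine ext _ _ fun p => ?_
    obtain ⟨i, k, j⟩ := p
    simp only [Equiv.Perm.mul_apply, hA1, hB, hC]
    refine lat_eq_iff.2 ⟨2 * v ^ 3 * tri (j + 1 + 1), 0, 2 * v ^ 2 * tri (j + 1 + 1), ?_, ?_, ?_⟩
    all_goals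
      simp only [stepA, stepB]
      rw [← Int.cast_inj (α := ℚ)]
      push_cast [cast_tri, cast_tet]
      ring
  have r2 : C * A = A ^ (1 + 2 * h * v) * C := by
    refine ext _ _ fun p => ?_
    rw [Equiv.Perm.mul_apply, Equiv.Perm.mul_apply, hA1, hC, hC, hA, lat_stepC_stepA h2 h3 hv]
  have r3 : B * C = C * B ^ (1 + 2 * h * v) := by
    refine ext _ _ fun p => ?_
    obtain ⟨i, k, j⟩ := p
    rw [Equiv.Perm.mul_apply, Equiv.Perm.mul_apply, hC, hB, hBpow, hC, stepB, stepC, stepC]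
    simp only
    exact lat_eq_iff.2 ⟨2 * v ^ 3, 0, 2 * v ^ 2, by ring, by ring, by ring⟩
  have hc : comm (op A) (op B) = op C := by
    have h4 : op A * op B = op B * op A * op C := congrArg op r1
    have h5 : comm (op A) (op B) = (op B * op A)⁻¹ * (op A * op B) := by simp [comm, mul_assoc]
    rw [h5, h4, inv_mul_cancel_left]
  refine ⟨⟨?_, ?_⟩, hc⟩
  · rw [conj, hc, mul_assoc, inv_mul_eq_iff_eq_mul]
    exact congrArg op r2
  · rw [conj, comm_swap (op A), hc, inv_inv, mul_inv_eq_iff_eq_mul]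
    exact congrArg op r3

open MulOpposite in
-- The word a^i c^k b^j moves the base point to the class of (i, k, j), so the action is transitive
-- and the size of the model is the index of a stabilizer.
theorem card_model_dvd (h0 : h ≠ 0) (h2 : Even h) (h3 : IsCoprime (h : ℤ) 3) (hv : Odd v) :
    16 * h ^ 7 ∣ Nat.card (MacdonaldGroup (1 + 2 * h * v)) := by
  obtain ⟨A, B, C, hA, hB, hC⟩ := exists_model_perms h0 h3 hv
  obtain ⟨hp, hc⟩ := macPair_perms h2 h3 hv hA hB hC
  obtain ⟨φ, hφA, hφB⟩ := hp.exists_hom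
  have hCpow : ∀ k i : ℕ, (C ^ k) (lat h (i, 0, 0)) = lat h (i, k, 0) := by
    intro k i
    induction k with
    | zero => simp
    | succ k ih => rw [pow_succ', Equiv.Perm.mul_apply, ih, hC, stepC]; simp
  have hBpow : ∀ j i k : ℕ, (B ^ j) (lat h (i, k, 0)) = lat h (i, k, j) := by
    intro j i k
    induction j with
    | zero => simp
    | succ j ih => rw [pow_succ', Equiv.Perm.mul_apply, ih, hB, stepB]; simp
  have hApow : ∀ i : ℕ, (A ^ i) (lat h (0, 0, 0)) = lat h (i, 0, 0) := by
    intro i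
    have := hA i (0, 0, 0)
    rw [zpow_natCast] at this
    rw [this]
    simp [iterA, tri, tet]
  -- Inversion turns the right action into a left one.
  let ψ : MacdonaldGroup (1 + 2 * h * v) →* Equiv.Perm (Model h) :=
    (MulEquiv.inv' (Equiv.Perm (Model h))).symm.toMonoidHom.comp φ
  have hψ : ∀ g, ψ g = (unop (φ g))⁻¹ := fun g => rfl
  let _ := MulAction.compHom (Model h) ψ
  have htrans : MulAction.IsPretransitive (MacdonaldGroup (1 + 2 * h * v)) (Model h) := by
    refine (MulAction.isPretransitive_iff_base (lat h (0, 0, 0))).2 ?_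
    intro x
    have : NeZero (4 * h ^ 3) := ⟨by simp [h0]⟩
    have : NeZero (2 * h ^ 2) := ⟨by simp [h0]⟩
    obtain ⟨i, k, j, rfl⟩ : ∃ i k j : ℕ, lat h (i, k, j) = x := by
      obtain ⟨x, y, z⟩ := x
      refine ⟨(x + z.val - h * y.val : ZMod (4 * h ^ 3)).val, y.val, z.val, ?_⟩
      simp [lat]
      ring
    refine ⟨(PresentedGroup.of 0 ^ i * comm (PresentedGroup.of 0) (PresentedGroup.of 1) ^ k *
      PresentedGroup.of 1 ^ j)⁻¹, ?_⟩
    change ψ _ (lat h (0, 0, 0)) = _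
    rw [hψ, map_inv, unop_inv, inv_inv, map_mul, map_mul, map_pow, map_pow, map_pow, map_comm,
      hφA, hφB, hc, unop_mul, unop_mul, unop_pow, unop_pow, unop_pow, unop_op, unop_op, unop_op,
      Equiv.Perm.mul_apply, Equiv.Perm.mul_apply, hApow, hCpow, hBpow]
  rw [← card_model, ← MulAction.index_stabilizer_of_transitive
    (MacdonaldGroup (1 + 2 * h * v)) (lat h (0, 0, 0))]
  exact Subgroup.index_dvd_card _

end

/-! ### Relations in the Sylow subgroup and uniqueness of the normal form. -/

theorem tri_succ (n : ℤ) : tri (n + 1) = tri n + n := by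
  rw [← Int.cast_inj (α := ℚ)]
  push_cast [cast_tri]
  ring

theorem tet_succ (n : ℤ) : tet (n + 1) = tet n + tri n := by
  rw [← Int.cast_inj (α := ℚ)]
  push_cast [cast_tri, cast_tet]
  ring

theorem geom_expand (x : ℤ) (n : ℕ) :
    ∃ q, geom (1 + x) n = n + x * tri n + x ^ 2 * tet n + x ^ 3 * q := by
  induction n with
  | zero => exact ⟨0, by simp [geom_zero, tri, tet]⟩
  | succ n ih =>
    obtain ⟨q, hq⟩ := ih
    refine ⟨q + x * q + tet n, ?_⟩
    rw [geom_succ, hq]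
    push_cast
    rw [tri_succ, tet_succ]
    ring

theorem pow_expand (x : ℤ) (n : ℕ) :
    ∃ q, (1 + x) ^ n = 1 + x * n + x ^ 2 * tri n + x ^ 3 * q := by
  obtain ⟨q, hq⟩ := geom_expand x n
  have := geom_mul (1 + x) n
  rw [hq] at this
  exact ⟨tet n + x * q, by linear_combination -this⟩

theorem defect_expand (x : ℤ) (n : ℕ) : ∃ q, defect (1 + x) n = x * tri n + x ^ 2 * q := by
  obtain ⟨q, hq⟩ := geom_expand x n
  obtain ⟨r, hr⟩ := pow_expand x n
  refine ⟨n * tri n + n * x * r - tri n - tet n - x * tet n - x * (1 + x) * q, ?_⟩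
  have h2 := two_mul_tri n
  rw [defect, hq, hr]
  linear_combination (-x) * h2

/-- The elements `a`, `b` generate the `2`-group `T`, which is at least as large as the Sylow
`2`-subgroup of the Macdonald group `G(α)` they come from, where `α = 1 + 2 * h * v`. -/
structure SylowPair {T : Type*} [Group T] (h : ℕ) (v : ℤ) (a b : T) : Prop where
  pair : MacPair (1 + 2 * h * v) a b
  gen : Subgroup.closure {a, b} = ⊤
  two_pow : ∃ l, h = 2 ^ (l + 1)
  odd : Odd v
  card : ∃ l, Nat.card T = 2 ^ l
  le_card : 16 * h ^ 7 ≤ Nat.card T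

namespace SylowPair

variable {T : Type*} [Group T] {h : ℕ} {v : ℤ} {a b : T}

theorem swap (S : SylowPair h v a b) : SylowPair h v b a :=
  ⟨S.pair.swap, by rw [Set.pair_comm]; exact S.gen, S.two_pow, S.odd, S.card, S.le_card⟩

theorem ne_zero (S : SylowPair h v a b) : (h : ℤ) ≠ 0 := by
  obtain ⟨l, rfl⟩ := S.two_pow
  simp

theorem even (S : SylowPair h v a b) : ∃ g : ℤ, (h : ℤ) = 2 * g := by
  obtain ⟨l, rfl⟩ := S.two_pow
  exact ⟨2 ^ l, by push_cast; ring⟩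

theorem coprime_odd (S : SylowPair h v a b) {f : ℤ} (hf : Odd f) : IsCoprime (h : ℤ) f := by
  obtain ⟨l, rfl⟩ := S.two_pow
  push_cast
  apply IsCoprime.pow_left
  obtain ⟨k, rfl⟩ := hf
  exact ⟨-k, 1, by ring⟩

theorem finite (S : SylowPair h v a b) : Finite T := by
  apply Nat.finite_of_card_ne_zero
  obtain ⟨l, hl⟩ := S.card
  rw [hl]; positivity

theorem eq_zpow_odd (S : SylowPair h v a b) {f : ℤ} (hf : Odd f) :
    ∃ g : ℤ, ∀ (x : T) (z : ℤ), x ^ (z * f * g) = x ^ z := by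
  obtain ⟨l, hl⟩ := S.card
  have hcop : IsCoprime f ((2 : ℤ) ^ l) := by
    apply IsCoprime.pow_right
    obtain ⟨k, rfl⟩ := hf
    exact ⟨1, -k, by ring⟩
  obtain ⟨g, r, hgr⟩ := hcop
  refine ⟨g, fun x z => ?_⟩
  have hx : x ^ 2 ^ l = 1 := by rw [← hl]; exact pow_card_eq_one'
  rw [show z * f * g = z + ((2 ^ l : ℕ) : ℤ) * (-(r * z)) by push_cast; linear_combination z * hgr,
    zpow_add, zpow_mul, zpow_natCast x (2 ^ l), hx, one_zpow, mul_one]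

theorem zpow_eq_one_of_odd (S : SylowPair h v a b) {x : T} {f z : ℤ} (hf : Odd f)
    (hx : x ^ (z * f) = 1) : x ^ z = 1 := by
  obtain ⟨g, hg⟩ := S.eq_zpow_odd hf
  rw [← hg, zpow_mul, hx, one_zpow]

theorem exists_defect (S : SylowPair h v a b) : ∃ f : ℤ, Odd f ∧ a ^ (2 * h ^ 2 * f) *
    b ^ (2 * h ^ 2 * f) = 1 ∧ a ^ (4 * h ^ 3 * v * f) = 1 := by
  obtain ⟨l, hl⟩ := S.card
  obtain ⟨k, hk⟩ := S.two_pow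
  -- For n ≡ α modulo M, the factor 2^l = |T| makes n-th powers equal α-th powers, and 4h keeps n -
  -- 1 equal to 2h times an odd number. Then `tri n` is h times an odd number and the defect is 2h²
  -- times an odd number.
  set M : ℤ := 4 * h * 2 ^ l with hM
  have hM0 : 0 < M := by have := S.ne_zero; positivity
  obtain ⟨n, t, hn⟩ : ∃ (n : ℕ) (t : ℤ), (n : ℤ) = 1 + 2 * h * v + M * t := by
    refine ⟨((1 + 2 * h * v) % M).toNat, -((1 + 2 * h * v) / M), ?_⟩
    rw [Int.toNat_of_nonneg (Int.emod_nonneg _ hM0.ne')]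
    have := Int.emod_add_mul_ediv (1 + 2 * h * v) M
    linear_combination this
  have hpow : ∀ x : T, x ^ n = x ^ (1 + 2 * h * v : ℤ) ^ 1 := by
    intro x
    have hx : x ^ 2 ^ l = 1 := by rw [← hl]; exact pow_card_eq_one'
    rw [← zpow_natCast, hn, pow_one, zpow_add,
      show M * t = ((2 ^ l : ℕ) : ℤ) * (4 * h * t) by rw [hM]; push_cast; ring,
      zpow_mul x, zpow_natCast x (2 ^ l), hx, one_zpow, mul_one]
  have r1 := S.pair.zpow_defect_mul_zpow_defect (hpow a) (hpow b)
  have r2 := S.pair.left_zpow_defect_mul (hpow a) (hpow b)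
  obtain ⟨q, hq⟩ := defect_expand (2 * h * v) n
  have htri : tri n = h * (n * (v + 2 * 2 ^ l * t)) := by
    have h1 := two_mul_tri n
    have h2 : (n : ℤ) - 1 = 2 * h * (v + 2 * 2 ^ l * t) := by rw [hn, hM]; ring
    rw [h2] at h1
    linarith
  have he : defect (1 + 2 * h * v) n
      = 2 * h ^ 2 * (v * (n * (v + 2 * 2 ^ l * t)) + 2 * v ^ 2 * q) := by
    rw [hq, htri]; ring
  have hodd : Odd (v * (n * (v + 2 * 2 ^ l * t)) + 2 * v ^ 2 * q) := by
    have h1 : Odd (n : ℤ) := by rw [hn, hM]; exact ⟨h * v + 2 * h * 2 ^ l * t, by ring⟩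
    have h2 : Odd (v + 2 * 2 ^ l * t) := by
      rw [mul_assoc]; exact S.odd.add_even (even_two_mul _)
    rw [mul_assoc 2 (v ^ 2)]
    exact (S.odd.mul (h1.mul h2)).add_even (even_two_mul _)
  refine ⟨_, hodd, ?_, ?_⟩
  · rw [← he]; exact r1
  · rw [he] at r2
    rw [← r2]
    congr 1; ring

theorem left_pow (S : SylowPair h v a b) (z : ℤ) : a ^ (4 * h ^ 3 * z) = 1 := by
  obtain ⟨f, hf, -, h1⟩ := S.exists_defect
  rw [mul_assoc (4 * (h : ℤ) ^ 3)] at h1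
  rw [zpow_mul, S.zpow_eq_one_of_odd (S.odd.mul hf) h1, one_zpow]

theorem right_zpow_eq (S : SylowPair h v a b) (z : ℤ) :
    b ^ (2 * h ^ 2 * z) = a ^ (-(2 * h ^ 2 * z)) := by
  obtain ⟨f, hf, h1, -⟩ := S.exists_defect
  have hb := eq_inv_of_mul_eq_one_right h1
  obtain ⟨g, hg⟩ := S.eq_zpow_odd hf
  have key : ∀ x : T, x ^ (2 * h ^ 2 * f * (g * z)) = x ^ (2 * h ^ 2 * z) := fun x => by
    rw [← hg x (2 * h ^ 2 * z)]
    congr 1; ring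
  rw [← key, zpow_mul, hb, inv_zpow, ← zpow_mul, key, zpow_neg]

/-- This element is a power of a and also a power of b. -/
theorem left_zpow_mem_center (S : SylowPair h v a b) (z : ℤ) :
    a ^ (2 * h ^ 2 * z) ∈ Subgroup.center T := by
  have h1 := S.swap.right_zpow_eq z
  rw [Subgroup.mem_center_iff]
  have hx : ∀ x ∈ Subgroup.closure {a, b}, x * a ^ (2 * h ^ 2 * z) = a ^ (2 * h ^ 2 * z) * x := by
    intro x hx
    induction hx using Subgroup.closure_induction with
    | mem x hx =>
      rcases hx with rfl | rfl
      · exact ((Commute.refl x).zpow_right _).eq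
      · rw [h1]; exact ((Commute.refl x).zpow_right _).eq
    | one => simp
    | mul x y _ _ h1 h2 => exact (Commute.mul_left h1 h2).eq
    | inv x _ h1 => exact (Commute.inv_left h1).eq
  exact fun x => hx x (S.gen ▸ Subgroup.mem_top x)

theorem commute_left (S : SylowPair h v a b) (z : ℤ) (x : T) : Commute (a ^ (2 * h ^ 2 * z)) x :=
  (Subgroup.mem_center_iff.1 (S.left_zpow_mem_center z) x).symm

/-- Take n = 2h² in `pow_mul_right`. As a^n is central, b cancels and c^n is a power of a, whose
exponent is 2h³v modulo 4h³, that is 2h³ since v is odd. -/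
theorem comm_zpow_eq (S : SylowPair h v a b) (z : ℤ) :
    comm a b ^ (2 * h ^ 2 * z) = a ^ (2 * h ^ 3 * z) := by
  have h1 := S.pair.pow_mul_right (2 * h ^ 2)
  have h2 := (S.commute_left 1 b).eq
  obtain ⟨q, hq⟩ := geom_expand (2 * h * v) (2 * h ^ 2)
  obtain ⟨s, hs⟩ := exists_tet_add (S.coprime_odd (f := 3) ⟨1, by norm_num⟩) 0 h
  have ht := tri_add h 0 h
  rw [show (0 : ℤ) + 2 * h * h = ((2 * h ^ 2 : ℕ) : ℤ) by push_cast; ring] at hs ht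
  rw [show tet 0 = 0 by rfl, zero_add] at hs
  rw [show tri 0 = 0 by rfl, zero_add] at ht
  obtain ⟨w, hw⟩ := S.odd
  have h3 : comm a b ^ (2 * h ^ 2) = a ^ (2 * h ^ 3 : ℤ) := by
    rw [← zpow_natCast a, show ((2 * h ^ 2 : ℕ) : ℤ) = 2 * h ^ 2 * 1 by push_cast; ring, h2] at h1
    have h4 := mul_left_cancel h1
    rw [hq, hs, ht] at h4
    have h5 : comm a b ^ (2 * h ^ 2) = a ^ (2 * h ^ 2 * 1 -
      (1 + 2 * h * v) * (((2 * h ^ 2 : ℕ) : ℤ) +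
      2 * h * v * (h * (h * (2 * 0 + 2 * h * h - 1))) + (2 * h * v) ^ 2 * (h * s) +
        (2 * h * v) ^ 3 * q) : ℤ) := by
      rw [zpow_sub, h4, mul_inv_cancel_right]
    obtain ⟨y, hy⟩ : ∃ y : ℤ, 2 * (h : ℤ) ^ 2 * 1 - (1 + 2 * h * v) * (((2 * h ^ 2 : ℕ) : ℤ) +
      2 * h * v * (h * (h * (2 * 0 + 2 * h * h - 1))) + (2 * h * v) ^ 2 * (h * s) +
        (2 * h * v) ^ 3 * q) = 2 * h ^ 3 + 4 * h ^ 3 * y := by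
      refine ⟨-v - h * v ^ 2 * (2 * h * h - 1) - v ^ 2 * (1 + 2 * h * v) * s -
        2 * v ^ 3 * (1 + 2 * h * v) * q - h ^ 2 * v + w, ?_⟩
      rw [hw]
      push_cast
      ring
    rw [h5, hy, zpow_add, S.left_pow, mul_one]
  rw [zpow_mul, show (2 * (h : ℤ) ^ 2) = ((2 * h ^ 2 : ℕ) : ℤ) by push_cast; rfl, zpow_natCast, h3,
    ← zpow_mul]

theorem left_inverse_exponent (S : SylowPair h v a b) :
    a ^ ((1 + 2 * h * v) * (1 - 2 * h * v + 4 * h ^ 2 * v ^ 2) : ℤ) = a := by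
  rw [show ((1 + 2 * h * v) * (1 - 2 * h * v + 4 * h ^ 2 * v ^ 2) : ℤ)
    = 4 * h ^ 3 * (2 * v ^ 3) + 1 by ring, zpow_add, S.left_pow, one_mul, zpow_one]

theorem normalForm_congr (S : SylowPair h v a b) {i k j i' k' j' : ℤ}
    (e : lat h (i, k, j) = lat h (i', k', j')) :
    a ^ i * comm a b ^ k * b ^ j = a ^ i' * comm a b ^ k' * b ^ j' := by
  obtain ⟨x, y, z, rfl, rfl, rfl⟩ := lat_eq_iff.1 e
  have h1 := S.commute_left (h * y) (comm a b ^ k')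
  have h2 := S.commute_left (z) (b ^ j')
  rw [show i' + 4 * h ^ 3 * x + 2 * h ^ 2 * z - 2 * h ^ 3 * y
    = i' + 2 * h ^ 2 * z + -(2 * h ^ 3 * y) + 4 * h ^ 3 * x by ring, zpow_add a _ (4 * h ^ 3 * x),
    S.left_pow, mul_one, zpow_add _ k', zpow_add _ j', S.comm_zpow_eq, S.right_zpow_eq,
    show 2 * (h : ℤ) ^ 3 * y = 2 * h ^ 2 * (h * y) by ring, zpow_add, zpow_add, zpow_neg,
    zpow_neg, ← h1.eq]
  have h3 := S.commute_left z (comm a b ^ k' * b ^ j')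
  calc a ^ i' * a ^ (2 * h ^ 2 * z) * (a ^ (2 * h ^ 2 * (h * y)))⁻¹ *
        (a ^ (2 * h ^ 2 * (h * y)) * comm a b ^ k') * (b ^ j' * (a ^ (2 * h ^ 2 * z))⁻¹)
      = a ^ i' * (a ^ (2 * h ^ 2 * z) * (comm a b ^ k' * b ^ j')) * (a ^ (2 * h ^ 2 * z))⁻¹ := by
        simp only [mul_assoc, inv_mul_cancel_left]
    _ = _ := by rw [h3.eq]; simp only [mul_assoc, mul_inv_cancel, mul_one]

theorem exists_nat_normalForm (S : SylowPair h v a b) (x : T) :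
    ∃ i k j : ℕ, x = a ^ i * comm a b ^ k * b ^ j := by
  obtain ⟨l, hl⟩ := S.card
  refine S.pair.exists_normalForm S.gen (N := 2 ^ l) (by positivity)
    (by rw [← hl]; exact pow_card_eq_one') (by rw [← hl]; exact pow_card_eq_one') ?_ x
  push_cast
  apply IsCoprime.pow_left
  exact ⟨-(h * v), 1, by ring⟩

/-- The normal form maps the model onto T, and the lower bound on |T| forces this surjection to be
injective. -/
theorem normalForm_eq_iff (S : SylowPair h v a b) {i k j i' k' j' : ℤ} :
    a ^ i * comm a b ^ k * b ^ j = a ^ i' * comm a b ^ k' * b ^ j' ↔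
      lat h (i, k, j) = lat h (i', k', j') := by
  refine ⟨fun e => ?_, S.normalForm_congr⟩
  have := S.finite
  let F : Model h → T := fun x =>
    a ^ (Function.surjInv (lat_surjective h) x).1 *
      comm a b ^ (Function.surjInv (lat_surjective h) x).2.1 *
      b ^ (Function.surjInv (lat_surjective h) x).2.2
  have hF : ∀ i k j : ℤ, F (lat h (i, k, j)) = a ^ i * comm a b ^ k * b ^ j := fun i k j =>
    S.normalForm_congr (Function.surjInv_eq (lat_surjective h) _)
  have hs : Function.Surjective F := by
    intro x
    obtain ⟨i, k, j, rfl⟩ := S.exists_nat_normalForm x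
    exact ⟨lat h (i, k, j), by rw [hF]; simp⟩
  have h0 : h ≠ 0 := by exact_mod_cast S.ne_zero
  have : NeZero (4 * h ^ 3) := ⟨by simp [h0]⟩
  have : NeZero (2 * h ^ 2) := ⟨by simp [h0]⟩
  have hb := hs.bijective_of_nat_card_le (by rw [card_model]; exact S.le_card)
  exact hb.1 (by rw [hF, hF, e])

theorem dvd_of_normalForm_eq (S : SylowPair h v a b) {i k j i' k' j' : ℤ}
    (e : a ^ i * comm a b ^ k * b ^ j = a ^ i' * comm a b ^ k' * b ^ j') :
    2 * (h : ℤ) ^ 2 ∣ i - i' ∧ 2 * (h : ℤ) ^ 2 ∣ k - k' ∧ 2 * (h : ℤ) ^ 2 ∣ j - j' := by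
  obtain ⟨x, y, z, rfl, rfl, rfl⟩ := lat_eq_iff.1 (S.normalForm_eq_iff.1 e)
  exact ⟨⟨2 * h * x + z - h * y, by ring⟩, ⟨y, by ring⟩, ⟨z, by ring⟩⟩

theorem dvd_of_left_zpow_eq_one (S : SylowPair h v a b) {i : ℤ} (e : a ^ i = 1) :
    4 * (h : ℤ) ^ 3 ∣ i := by
  have e' : a ^ i * comm a b ^ (0 : ℤ) * b ^ (0 : ℤ) =
      a ^ (0 : ℤ) * comm a b ^ (0 : ℤ) * b ^ (0 : ℤ) := by
    rw [e, zpow_zero a]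
  obtain ⟨x, y, z, hi, hk, hj⟩ := lat_eq_iff.1 (S.normalForm_eq_iff.1 e')
  have h0 : h ≠ 0 := by exact_mod_cast S.ne_zero
  have hy : y = 0 := by
    have : 2 * (h : ℤ) ^ 2 * y = 0 := by linarith
    simpa [h0] using this
  have hz : z = 0 := by
    have : 2 * (h : ℤ) ^ 2 * z = 0 := by linarith
    simpa [h0] using this
  subst hy hz
  exact ⟨x, by linarith⟩

/-- Conjugation to first order in 2hv: the remaining terms are multiples of 4h², invisible when
exponents are compared modulo 2h². -/
theorem inv_mul_mul_left (S : SylowPair h v a b) (i k j : ℕ) : ∃ q r : ℤ,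
    a⁻¹ * (a ^ i * comm a b ^ k * b ^ j) * a = a ^ (i - 2 * h * v * k + 4 * h ^ 2 * r : ℤ) *
      comm a b ^ (k - j : ℤ) * b ^ (j + 2 * h * v * tri (j + 1) + 4 * h ^ 2 * q : ℤ) := by
  have h1 := S.pair.mul_left_normalForm S.left_inverse_exponent i k j
  obtain ⟨q, hq⟩ := geom_expand (2 * h * v) j
  obtain ⟨r, hr⟩ := pow_expand (2 * h * v * (-1 + 2 * h * v)) k
  refine ⟨v ^ 2 * tet j + 2 * h * v ^ 3 * q + v ^ 2 * (tri j + 2 * h * v * tet j +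
    (2 * h * v) ^ 2 * q), v ^ 2 * k + v ^ 2 * (-1 + 2 * h * v) ^ 2 * tri k
      + 2 * h * v ^ 3 * (-1 + 2 * h * v) ^ 3 * r, ?_⟩
  have e1 : -1 + (i + (1 - 2 * h * v + 4 * h ^ 2 * v ^ 2) ^ k) = i - 2 * h * v * k + 4 * h ^ 2 *
      (v ^ 2 * k + v ^ 2 * (-1 + 2 * h * v) ^ 2 * tri k
      + 2 * h * v ^ 3 * (-1 + 2 * h * v) ^ 3 * r) := by
    rw [show (1 - 2 * h * v + 4 * h ^ 2 * v ^ 2 : ℤ) = 1 + 2 * h * v * (-1 + 2 * h * v) by ring, hr]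
    ring
  have e2 : (1 + 2 * h * v) * geom (1 + 2 * h * v) j = j + 2 * h * v * tri (j + 1) + 4 * h ^ 2 *
      (v ^ 2 * tet j + 2 * h * v ^ 3 * q + v ^ 2 * (tri j + 2 * h * v * tet j +
      (2 * h * v) ^ 2 * q)) := by
    rw [hq, tri_succ]
    ring
  rw [mul_assoc, h1, ← e1, ← e2, zpow_add a (-1), zpow_neg_one]
  simp only [mul_assoc]

theorem inv_mul_mul_right (S : SylowPair h v a b) (i k j : ℕ) : ∃ q r : ℤ,
    b⁻¹ * (a ^ i * comm a b ^ k * b ^ j) * b = a ^ (i - 2 * h * v * tri i + 4 * h ^ 2 * r : ℤ) *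
      comm a b ^ (k + i : ℤ) * b ^ (j + 2 * h * v * k + 4 * h ^ 2 * q : ℤ) := by
  set β : ℤ := 1 - 2 * h * v + 4 * h ^ 2 * v ^ 2 with hβ
  have hβ' : β = 1 + 2 * h * v * (-1 + 2 * h * v) := by rw [hβ]; ring
  have h1 := S.pair.pow_mul_right i
  have h2 := S.pair.zpow_mul_comm_pow_right S.swap.left_inverse_exponent k (-1)
  have h3 := S.pair.comm_pow_mul_zpow_left S.left_inverse_exponent i
    ((1 + 2 * h * v) * geom (1 + 2 * h * v) i)
  obtain ⟨q, hq⟩ := geom_expand (2 * h * v) i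
  obtain ⟨r, hr⟩ := pow_expand (2 * h * v * (-1 + 2 * h * v)) k
  obtain ⟨s, hs⟩ := pow_expand (2 * h * v * (-1 + 2 * h * v)) i
  rw [← hβ'] at hr hs
  have e1 : b⁻¹ * a ^ i * b
      = a ^ (β ^ i * ((1 + 2 * h * v) * geom (1 + 2 * h * v) i)) * comm a b ^ i := by
    rw [mul_assoc, h1, inv_mul_cancel_left, ← h3]
  have e2 : b⁻¹ * comm a b ^ k * b = comm a b ^ k * b ^ (β ^ k * -1 + 1) := by
    rw [← zpow_neg_one b, h2, zpow_add, zpow_one, mul_assoc]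
  have e3 : b⁻¹ * (a ^ i * comm a b ^ k * b ^ j) * b
      = (b⁻¹ * a ^ i * b) * (b⁻¹ * comm a b ^ k * b) * b ^ j := by
    have := pow_succ b j
    rw [pow_succ'] at this
    simp only [mul_assoc]
    rw [← this]
    simp only [mul_inv_cancel_left]
  have e4 : ∃ r : ℤ, β ^ i * ((1 + 2 * h * v) * geom (1 + 2 * h * v) i)
      = i - 2 * h * v * tri i + 4 * h ^ 2 * r := by
    have h4 := two_mul_tri i
    set u : ℤ := 2 * h * v with hu
    obtain ⟨P, hP⟩ : ∃ P, β ^ i = 1 - u * i + u ^ 2 * P :=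
      ⟨i + (-1 + u) ^ 2 * tri i + u * (-1 + u) ^ 3 * s, by rw [hs]; ring⟩
    obtain ⟨Q, hQ⟩ : ∃ Q, (1 + u) * geom (1 + u) i = i + u * (i + tri i) + u ^ 2 * Q :=
      ⟨tri i + tet i + u * tet i + u * (1 + u) * q, by rw [hq]; ring⟩
    refine ⟨v ^ 2 * (Q * (1 - u * i + u ^ 2 * P) + P * (i + u * (i + tri i)) - i * (i + tri i)), ?_⟩
    rw [hP, hQ]
    have hu2 : u ^ 2 = 4 * h ^ 2 * v ^ 2 := by rw [hu]; ring
    rw [← mul_assoc (4 * (h : ℤ) ^ 2), ← hu2]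
    linear_combination u * h4
  obtain ⟨t, ht⟩ := e4
  refine ⟨-v ^ 2 * k - v ^ 2 * (-1 + 2 * h * v) ^ 2 * tri k
      - 2 * h * v ^ 3 * (-1 + 2 * h * v) ^ 3 * r, t, ?_⟩
  rw [e3, e1, e2, ht]
  have e5 : β ^ k * -1 + 1 + j = j + 2 * h * v * k + 4 * h ^ 2 *
      (-v ^ 2 * k - v ^ 2 * (-1 + 2 * h * v) ^ 2 * tri k
      - 2 * h * v ^ 3 * (-1 + 2 * h * v) ^ 3 * r) := by
    rw [hr]; ring
  rw [← e5, zpow_add b _ (j : ℤ), zpow_add (comm a b), zpow_natCast, zpow_natCast, zpow_natCast,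
    ← pow_add, add_comm k i, pow_add]
  simp only [mul_assoc]

end SylowPair

/-! ### The first three terms of the upper central series. -/

theorem mul_comm_eq {T : Type*} [Group T] (x s : T) : s⁻¹ * x * s = x * comm x s := by
  simp [comm, mul_assoc]

namespace SylowPair

variable {T : Type*} [Group T] {h : ℕ} {v : ℤ} {a b : T}

theorem dvd_of_dvd_mul (S : SylowPair h v a b) {k : ℤ} (hk : 2 * (h : ℤ) ^ 2 ∣ 2 * h * v * k) :
    (h : ℤ) ∣ k := by
  have h1 : (h : ℤ) ∣ v * k := by
    apply Int.dvd_of_mul_dvd_mul_left (a := 2 * (h : ℤ)) (by have := S.ne_zero; positivity)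
    obtain ⟨c, hc⟩ := hk
    exact ⟨c, by linear_combination hc⟩
  exact (S.coprime_odd S.odd).dvd_of_dvd_mul_left h1

/-- Since h is even and divides n, the neighbour f of n is odd; so h ∣ t improves to 2h ∣ n. -/
theorem two_mul_dvd (S : SylowPair h v a b) {n t f : ℤ} (hn : (h : ℤ) ∣ n)
    (ht : 2 * (h : ℤ) ^ 2 ∣ 2 * h * v * t) (e : 2 * t = n * f) (hf : f = n - 1 ∨ f = n + 1) :
    2 * (h : ℤ) ∣ n := by
  have h1 := S.dvd_of_dvd_mul ht
  obtain ⟨g, hg⟩ := S.even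
  obtain ⟨s, hs⟩ := hn
  have hodd : Odd f := by
    rcases hf with rfl | rfl
    · exact ⟨g * s - 1, by rw [hs, hg]; ring⟩
    · exact ⟨g * s, by rw [hs, hg]; ring⟩
  have hcop : IsCoprime (2 * (h : ℤ)) f := by
    refine IsCoprime.mul_left ?_ (S.coprime_odd hodd)
    obtain ⟨k, rfl⟩ := hodd
    exact ⟨-k, 1, by ring⟩
  apply hcop.dvd_of_dvd_mul_right
  rw [← e]
  exact mul_dvd_mul_left 2 h1

theorem commute_comm_pow_of_dvd (S : SylowPair h v a b) {t : ℤ} {k : ℕ}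
    (hk : 4 * (h : ℤ) ^ 3 ∣ 2 * h * k * t) : Commute (a ^ t) (comm a b ^ k) := by
  obtain ⟨q, hq⟩ := pow_expand (2 * h * v) k
  obtain ⟨g, hg⟩ := S.even
  obtain ⟨r, hr⟩ := hk
  have h2 := two_mul_tri k
  have e : (1 + 2 * h * v : ℤ) ^ k * t
      = t + 4 * h ^ 3 * (v * r + h * v ^ 2 * (k - 1) * r + 2 * v ^ 3 * q * t) := by
    rw [hq]
    linear_combination (v + h * v ^ 2 * (k - 1)) * hr + 2 * h ^ 2 * v ^ 2 * t * h2
  have h1 := S.pair.zpow_mul_comm_pow t k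
  rw [e, zpow_add, S.left_pow, mul_one] at h1
  exact h1

theorem left_zpow_mem_one (S : SylowPair h v a b) (s : ℤ) :
    a ^ (2 * h ^ 2 * s) ∈ Subgroup.upperCentralSeries T 1 := by
  rw [Subgroup.upperCentralSeries_one]
  exact S.left_zpow_mem_center s

theorem right_zpow_mem_one (S : SylowPair h v a b) (s : ℤ) :
    b ^ (2 * h ^ 2 * s) ∈ Subgroup.upperCentralSeries T 1 :=
  S.swap.left_zpow_mem_one s

theorem comm_pow_mem_two (S : SylowPair h v a b) :
    comm a b ^ h ∈ Subgroup.upperCentralSeries T 2 := by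
  obtain ⟨q, hq⟩ := pow_expand (2 * h * v) h
  have e : (1 - (1 + 2 * h * v) ^ h : ℤ)
      = 2 * h ^ 2 * (-v - 2 * v ^ 2 * tri h - 4 * h * v ^ 3 * q) := by rw [hq]; ring
  refine mem_upperCentralSeries_succ S.gen ?_
  rintro y (rfl | rfl)
  · rw [S.pair.comm_comm_pow_left, e]
    exact S.left_zpow_mem_one _
  · refine S.pair.comm_mem ?_
    rw [e]
    exact S.right_zpow_mem_one _

theorem left_pow_mem_three (S : SylowPair h v a b) :
    a ^ (2 * h) ∈ Subgroup.upperCentralSeries T 3 := by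
  refine mem_upperCentralSeries_succ S.gen ?_
  rintro y (rfl | rfl)
  · rw [comm_pow_self]; exact one_mem _
  · rw [S.pair.comm_pow_comm]
    refine mul_mem ?_ (Subgroup.upperCentralSeries_mono T one_le_two ?_)
    · rw [mul_comm, pow_mul]
      exact pow_mem S.comm_pow_mem_two _
    · obtain ⟨q, hq⟩ := defect_expand (2 * h * v) (2 * h)
      have ht := tri_add h 0 1
      rw [show (0 : ℤ) + 2 * h * 1 = ((2 * h : ℕ) : ℤ) by push_cast; ring,
        show tri 0 = 0 by rfl, zero_add] at ht
      rw [hq, ht, show -(2 * h * v * (h * (1 * (2 * 0 + 2 * h * 1 - 1))) + (2 * h * v) ^ 2 * q)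
        = 2 * (h : ℤ) ^ 2 * (-(v * (2 * h - 1)) - 2 * v ^ 2 * q) by ring]
      exact S.left_zpow_mem_one _

theorem right_pow_mem_three (S : SylowPair h v a b) :
    b ^ (2 * h) ∈ Subgroup.upperCentralSeries T 3 :=
  S.swap.left_pow_mem_three

/-- Conjugation by a and b shifts the exponent of c by -j and i, so 2h² divides both. Then a^i and
b^j are central, c^k commutes with a, and this forces 2h² ∣ k. -/
theorem exists_of_mem_one (S : SylowPair h v a b) {x : T}
    (hx : x ∈ Subgroup.upperCentralSeries T 1) : ∃ s : ℤ, x = a ^ (2 * h ^ 2 * s) := by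
  rw [Subgroup.upperCentralSeries_one, Subgroup.mem_center_iff] at hx
  obtain ⟨i, k, j, rfl⟩ := S.exists_nat_normalForm x
  have ha : a⁻¹ * (a ^ i * comm a b ^ k * b ^ j) * a =
      a ^ (i : ℤ) * comm a b ^ (k : ℤ) * b ^ (j : ℤ) := by
    rw [mul_assoc, ← hx, inv_mul_cancel_left]
    simp only [zpow_natCast]
  have hb : b⁻¹ * (a ^ i * comm a b ^ k * b ^ j) * b =
      a ^ (i : ℤ) * comm a b ^ (k : ℤ) * b ^ (j : ℤ) := by
    rw [mul_assoc, ← hx, inv_mul_cancel_left]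
    simp only [zpow_natCast]
  obtain ⟨q, r, h1⟩ := S.inv_mul_mul_left i k j
  obtain ⟨q', r', h2⟩ := S.inv_mul_mul_right i k j
  obtain ⟨-, h3, -⟩ := S.dvd_of_normalForm_eq (h1.symm.trans ha)
  obtain ⟨-, h4, -⟩ := S.dvd_of_normalForm_eq (h2.symm.trans hb)
  obtain ⟨j', hj⟩ : 2 * (h : ℤ) ^ 2 ∣ (j : ℤ) := by
    obtain ⟨c, hc⟩ := h3
    exact ⟨-c, by linear_combination -hc⟩
  obtain ⟨i', hi⟩ : 2 * (h : ℤ) ^ 2 ∣ (i : ℤ) := by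
    obtain ⟨c, hc⟩ := h4
    exact ⟨c, by linear_combination hc⟩
  have ei : a ^ i = a ^ (2 * h ^ 2 * i' : ℤ) := by rw [← hi, zpow_natCast]
  have ej : b ^ j = a ^ (2 * h ^ 2 * -j' : ℤ) := by
    rw [← zpow_natCast, hj, S.right_zpow_eq]; congr 1; ring
  have hk : Commute a (comm a b ^ k) := by
    have h5 : Commute a (a ^ i * comm a b ^ k * b ^ j) := hx a
    have h6 : comm a b ^ k = (a ^ i)⁻¹ * (a ^ i * comm a b ^ k * b ^ j) * (b ^ j)⁻¹ := by group
    rw [h6]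
    refine Commute.mul_right (Commute.mul_right ?_ h5) ?_
    · exact ((Commute.refl a).pow_right i).inv_right
    · rw [ej]; exact ((Commute.refl a).zpow_right _).inv_right
  obtain ⟨k', hk'⟩ : 2 * (h : ℤ) ^ 2 ∣ (k : ℤ) := by
    have h5 := S.pair.zpow_mul_comm_pow 1 k
    rw [zpow_one, hk.eq, mul_one] at h5
    have h6 := mul_left_cancel h5
    obtain ⟨s, hs⟩ : 4 * (h : ℤ) ^ 3 ∣ (1 + 2 * h * v) ^ k - 1 :=
      S.dvd_of_left_zpow_eq_one (by rw [zpow_sub, ← h6]; simp)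
    obtain ⟨q, hq⟩ := pow_expand (2 * h * v) k
    have h7 := two_mul_tri k
    obtain ⟨g, hg⟩ := S.even
    -- Modulo 8h³, α^k - 1 is 2hk·v(1 + hv(k-1)), and the cofactor of 2hk is odd because h is even.
    have h8 : 2 * (h : ℤ) ^ 2 ∣ k * (v * (1 + h * v * (k - 1))) := by
      apply Int.dvd_of_mul_dvd_mul_left (a := 2 * (h : ℤ)) (by have := S.ne_zero; positivity)
      exact ⟨s - 2 * v ^ 3 * q, by linear_combination -hq + hs - 2 * h ^ 2 * v ^ 2 * h7⟩
    have hodd : Odd (v * (1 + h * v * (k - 1))) := by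
      refine S.odd.mul ⟨g * v * (k - 1), by rw [hg]; ring⟩
    refine IsCoprime.dvd_of_dvd_mul_right ?_ h8
    refine IsCoprime.mul_left ?_ (IsCoprime.pow_left (S.coprime_odd hodd))
    obtain ⟨k, hk⟩ := hodd
    rw [hk]
    exact ⟨-k, 1, by ring⟩
  have ek : comm a b ^ k = a ^ (2 * h ^ 2 * (h * k') : ℤ) := by
    rw [← zpow_natCast, hk', S.comm_zpow_eq]; congr 1; ring
  exact ⟨i' + h * k' - j', by rw [ei, ek, ej, ← zpow_add, ← zpow_add]; congr 1; ring⟩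

/-- Multiplying by a central a^(2h²s) does not touch the exponent of c, so i and j are constrained
as for the center; the exponent of b after conjugation by b gives h ∣ k. -/
theorem exists_of_mem_two (S : SylowPair h v a b) {x : T}
    (hx : x ∈ Subgroup.upperCentralSeries T 2) :
    ∃ (s : ℤ) (t : ℕ), x = a ^ (2 * h ^ 2 * s) * comm a b ^ (h * t) := by
  obtain ⟨i, k, j, rfl⟩ := S.exists_nat_normalForm x
  obtain ⟨s, hs⟩ := S.exists_of_mem_one (comm_mem_upperCentralSeries hx a)
  obtain ⟨s', hs'⟩ := S.exists_of_mem_one (comm_mem_upperCentralSeries hx b)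
  obtain ⟨q, r, h1⟩ := S.inv_mul_mul_left i k j
  obtain ⟨q', r', h2⟩ := S.inv_mul_mul_right i k j
  have key : ∀ s : ℤ, a ^ i * comm a b ^ k * b ^ j * a ^ (2 * h ^ 2 * s : ℤ)
      = a ^ (i + 2 * h ^ 2 * s : ℤ) * comm a b ^ (k : ℤ) * b ^ (j : ℤ) := by
    intro s
    rw [← (S.commute_left s _).eq, add_comm, zpow_add]
    simp only [zpow_natCast, mul_assoc]
  rw [mul_comm_eq, hs, key] at h1
  rw [mul_comm_eq, hs', key] at h2
  obtain ⟨-, h3, -⟩ := S.dvd_of_normalForm_eq h1.symm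
  obtain ⟨-, h4, h5⟩ := S.dvd_of_normalForm_eq h2.symm
  obtain ⟨j', hj⟩ : 2 * (h : ℤ) ^ 2 ∣ (j : ℤ) := by
    obtain ⟨c, hc⟩ := h3
    exact ⟨-c, by linear_combination -hc⟩
  obtain ⟨i', hi⟩ : 2 * (h : ℤ) ^ 2 ∣ (i : ℤ) := by
    obtain ⟨c, hc⟩ := h4
    exact ⟨c, by linear_combination hc⟩
  obtain ⟨k', hk⟩ : (h : ℤ) ∣ k := by
    apply S.dvd_of_dvd_mul
    obtain ⟨c, hc⟩ := h5
    exact ⟨c - 2 * q', by linear_combination hc⟩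
  obtain ⟨t, ht⟩ := Int.natCast_dvd_natCast.1 ⟨k', hk⟩
  refine ⟨i' - j', t, ?_⟩
  have ei : a ^ i = a ^ (2 * h ^ 2 * i' : ℤ) := by rw [← hi, zpow_natCast]
  have ej : b ^ j = a ^ (2 * h ^ 2 * -j' : ℤ) := by
    rw [← zpow_natCast, hj, S.right_zpow_eq]; congr 1; ring
  rw [ei, ej, ← ht, mul_assoc (a ^ _), ← (S.commute_left (-j') _).eq, ← mul_assoc (a ^ _),
    ← zpow_add]
  congr 2; ring

/-- The commutators may now contain c^(ht), so the exponents of c only yield h ∣ i and h ∣ j. The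
exponents of a and b contribute h ∣ `tri i` and h ∣ `tri (j + 1)`, which supply the missing factor
2. -/
theorem dvd_of_mem_three (S : SylowPair h v a b) {i k j : ℕ}
    (hx : a ^ i * comm a b ^ k * b ^ j ∈ Subgroup.upperCentralSeries T 3) :
    2 * (h : ℤ) ∣ i ∧ (h : ℤ) ∣ k ∧ 2 * (h : ℤ) ∣ j := by
  obtain ⟨s, t, hs⟩ := S.exists_of_mem_two (comm_mem_upperCentralSeries hx a)
  obtain ⟨s', t', hs'⟩ := S.exists_of_mem_two (comm_mem_upperCentralSeries hx b)
  obtain ⟨q, r, h1⟩ := S.inv_mul_mul_left i k j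
  obtain ⟨q', r', h2⟩ := S.inv_mul_mul_right i k j
  have key : ∀ (s : ℤ) (t : ℕ), ∃ d : ℤ, a ^ i * comm a b ^ k * b ^ j *
      (a ^ (2 * h ^ 2 * s : ℤ) * comm a b ^ (h * t)) = a ^ (i + 2 * h ^ 2 * s : ℤ) *
        comm a b ^ (k + h * t : ℤ) * b ^ (j + 2 * h ^ 2 * d : ℤ) := by
    intro s t
    obtain ⟨q, hq⟩ := pow_expand (2 * h * v * (-1 + 2 * h * v)) (h * t)
    have h3 := S.pair.zpow_mul_comm_pow_right S.swap.left_inverse_exponent (h * t) j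
    refine ⟨(v * (-1 + 2 * h * v) * t + 2 * v ^ 2 * (-1 + 2 * h * v) ^ 2 * tri (h * t : ℕ) +
      4 * h * v ^ 3 * (-1 + 2 * h * v) ^ 3 * q) * j, ?_⟩
    have e : (j + 2 * h ^ 2 * ((v * (-1 + 2 * h * v) * t +
        2 * v ^ 2 * (-1 + 2 * h * v) ^ 2 * tri (h * t : ℕ) +
        4 * h * v ^ 3 * (-1 + 2 * h * v) ^ 3 * q) * j) : ℤ)
        = (1 - 2 * h * v + 4 * h ^ 2 * v ^ 2) ^ (h * t) * j := by
      rw [show (1 - 2 * h * v + 4 * h ^ 2 * v ^ 2 : ℤ) = 1 + 2 * h * v * (-1 + 2 * h * v) by ring,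
        hq]
      push_cast
      ring
    rw [e, ← mul_assoc, ← (S.commute_left s _).eq, add_comm, zpow_add,
      show (k + h * t : ℤ) = ((k + h * t : ℕ) : ℤ) by push_cast; ring, zpow_natCast, zpow_natCast,
      pow_add]
    rw [zpow_natCast] at h3
    simp only [mul_assoc (G := T)]
    rw [h3]
  obtain ⟨d, hd⟩ := key s t
  obtain ⟨d', hd'⟩ := key s' t'
  rw [mul_comm_eq, hs, hd] at h1
  rw [mul_comm_eq, hs', hd'] at h2
  obtain ⟨h3, h4, h5⟩ := S.dvd_of_normalForm_eq h1.symm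
  obtain ⟨h6, h7, h8⟩ := S.dvd_of_normalForm_eq h2.symm
  have hi : (h : ℤ) ∣ i := by
    obtain ⟨c, hc⟩ := h7
    exact ⟨t' + 2 * h * c, by linear_combination hc⟩
  have hj : (h : ℤ) ∣ j := by
    obtain ⟨c, hc⟩ := h4
    exact ⟨-t - 2 * h * c, by linear_combination -hc⟩
  refine ⟨S.two_mul_dvd hi ?_ (two_mul_tri i) (Or.inl rfl), ?_,
    S.two_mul_dvd (t := tri (j + 1)) (f := j + 1) hj ?_ ?_ (Or.inr rfl)⟩
  · obtain ⟨c, hc⟩ := h6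
    exact ⟨-c + 2 * r' - s', by linear_combination -hc⟩
  · apply S.dvd_of_dvd_mul
    obtain ⟨c, hc⟩ := h8
    exact ⟨c - 2 * q' + d', by linear_combination hc⟩
  · obtain ⟨c, hc⟩ := h5
    exact ⟨c - 2 * q + d, by linear_combination hc⟩
  · rw [two_mul_tri]; ring

theorem mem_three_iff (S : SylowPair h v a b) {x : T} :
    x ∈ Subgroup.upperCentralSeries T 3 ↔
      ∃ i k j : ℤ, x = (a ^ (2 * h)) ^ i * (comm a b ^ h) ^ k * (b ^ (2 * h)) ^ j := by
  constructor
  · intro hx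
    obtain ⟨i, k, j, rfl⟩ := S.exists_nat_normalForm x
    obtain ⟨⟨i', hi⟩, ⟨k', hk⟩, ⟨j', hj⟩⟩ := S.dvd_of_mem_three hx
    refine ⟨i', k', j', ?_⟩
    rw [← zpow_natCast a (2 * h), ← zpow_natCast b (2 * h), ← zpow_natCast _ h, ← zpow_mul,
      ← zpow_mul, ← zpow_mul, Nat.cast_mul, Nat.cast_ofNat, ← hi, ← hk, ← hj]
    simp only [zpow_natCast]
  · rintro ⟨i, k, j, rfl⟩
    refine mul_mem (mul_mem (zpow_mem S.left_pow_mem_three _) (zpow_mem ?_ _))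
      (zpow_mem S.right_pow_mem_three _)
    exact Subgroup.upperCentralSeries_mono T (by norm_num) S.comm_pow_mem_two

theorem commute_left_comm (S : SylowPair h v a b) : Commute (a ^ (2 * h)) (comm a b ^ h) := by
  rw [← zpow_natCast a]
  exact S.commute_comm_pow_of_dvd ⟨1, by push_cast; ring⟩

theorem commute_right_comm (S : SylowPair h v a b) : Commute (b ^ (2 * h)) (comm a b ^ h) := by
  have := S.swap.commute_left_comm
  rw [comm_swap a b, inv_pow] at this
  simpa using this.inv_right

/-- Let y = b^(2h). Then w = [a, y] lies in Z₂ and commutes with c, and y conjugates c to a central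
multiple of itself. Conjugating a^α = c⁻¹ac by y thus gives a^α w, while a goes to aw; so y fixes
a^(α-1) = a^(2hv), and the odd v can be removed. -/
theorem commute_left_right (S : SylowPair h v a b) : Commute (a ^ (2 * h)) (b ^ (2 * h)) := by
  set y := b ^ (2 * h) with hy
  set c := comm a b with hc
  obtain ⟨s, t, hw⟩ := S.exists_of_mem_two
    (inv_mem (comm_mem_upperCentralSeries S.right_pow_mem_three a))
  rw [← hy, ← comm_swap] at hw
  have hwc : Commute (comm a y) c := by
    rw [hw]
    exact (S.commute_left s c).mul_left ((Commute.refl c).pow_left _)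
  have h1 : y⁻¹ * a * y = a * comm a y := mul_comm_eq a y
  have h2 : y⁻¹ * c * y = a ^ (2 * h ^ 2 * (-2 * v) : ℤ) * c := by
    have h3 := S.pair.comm_mul_zpow (2 * h : ℕ)
    rw [zpow_natCast, ← hy] at h3
    rw [mul_assoc, h3, ← mul_assoc, hy, ← zpow_natCast, ← zpow_neg, ← zpow_add,
      show (-((2 * h : ℕ) : ℤ) + (1 + 2 * h * v) * ((2 * h : ℕ) : ℤ)) = 2 * h ^ 2 * (2 * v) by
        push_cast; ring, S.right_zpow_eq]
    congr 2; ring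
  have h3 : a ^ (1 + 2 * h * v : ℤ) = c⁻¹ * a * c := S.pair.left.symm
  have h4 : y⁻¹ * a ^ (1 + 2 * h * v : ℤ) * y = a ^ (1 + 2 * h * v : ℤ) * comm a y := by
    have e : y⁻¹ * (c⁻¹ * a * c) * y = (y⁻¹ * c * y)⁻¹ * (y⁻¹ * a * y) * (y⁻¹ * c * y) := by group
    have hz := S.commute_left (-2 * v) (a * comm a y)
    rw [h3, e, h1, h2]
    generalize a ^ (2 * (h : ℤ) ^ 2 * (-2 * v)) = z at hz
    generalize comm a y = w at hz hwc
    have e1 : (z * c)⁻¹ * (a * w) * (z * c) = c⁻¹ * (z⁻¹ * (a * w * z)) * c := by group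
    have e2 : c⁻¹ * (a * w) * c = c⁻¹ * a * (w * c) := by group
    rw [e1, ← hz.eq, inv_mul_cancel_left, e2, hwc.eq]
    group
  have h5 : y⁻¹ * a ^ (2 * h * v : ℤ) * y = a ^ (2 * h * v : ℤ) := by
    have e : a ^ (2 * h * v : ℤ) = a ^ (1 + 2 * h * v : ℤ) * a⁻¹ := by
      rw [add_comm, zpow_add, zpow_one, mul_inv_cancel_right]
    have e2 : y⁻¹ * (a ^ (1 + 2 * h * v : ℤ) * a⁻¹) * y
        = (y⁻¹ * a ^ (1 + 2 * h * v : ℤ) * y) * (y⁻¹ * a * y)⁻¹ := by group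
    rw [e, e2, h4, h1]
    group
  have h6 : Commute (a ^ (2 * h * v : ℤ)) y := by
    rw [mul_assoc, inv_mul_eq_iff_eq_mul] at h5
    exact h5
  obtain ⟨g, hg⟩ := S.eq_zpow_odd S.odd
  have h7 := hg a (2 * h : ℕ)
  rw [zpow_natCast] at h7
  rw [← h7, zpow_mul]
  push_cast
  exact h6.zpow_left g

theorem commute_of_mem_three (S : SylowPair h v a b) {x y : T}
    (hx : x ∈ Subgroup.upperCentralSeries T 3) (hy : y ∈ Subgroup.upperCentralSeries T 3) :
    Commute x y := by
  obtain ⟨i, k, j, rfl⟩ := S.mem_three_iff.1 hx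
  obtain ⟨i', k', j', rfl⟩ := S.mem_three_iff.1 hy
  have h1 := S.commute_left_comm
  have h2 := S.commute_right_comm
  have h3 := S.commute_left_right
  have ha : ∀ n : ℤ, Commute ((a ^ (2 * h)) ^ n)
      ((a ^ (2 * h)) ^ i' * (comm a b ^ h) ^ k' * (b ^ (2 * h)) ^ j') := fun n =>
    (((Commute.refl _).zpow_zpow _ _).mul_right (h1.zpow_zpow _ _)).mul_right (h3.zpow_zpow _ _)
  have hb : ∀ n : ℤ, Commute ((b ^ (2 * h)) ^ n)
      ((a ^ (2 * h)) ^ i' * (comm a b ^ h) ^ k' * (b ^ (2 * h)) ^ j') := fun n =>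
    ((h3.symm.zpow_zpow _ _).mul_right (h2.zpow_zpow _ _)).mul_right
      ((Commute.refl _).zpow_zpow _ _)
  have hc : ∀ n : ℤ, Commute ((comm a b ^ h) ^ n)
      ((a ^ (2 * h)) ^ i' * (comm a b ^ h) ^ k' * (b ^ (2 * h)) ^ j') := fun n =>
    ((h1.symm.zpow_zpow _ _).mul_right ((Commute.refl _).zpow_zpow _ _)).mul_right
      (h2.symm.zpow_zpow _ _)
  exact ((ha i).mul_left (hc k)).mul_left (hb j)

end SylowPair

/-! ### The Heisenberg quotient. -/

namespace Heis

variable {R : Type*} [CommRing R]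

theorem zpow_eq_of_mul_eq_zero {g : Heis R} (hg : g.a * g.b = 0) (n : ℤ) :
    g ^ n = ⟨n * g.a, n * g.b, n * g.c⟩ := by
  have h1 : g⁻¹ = ⟨-g.a, -g.b, -g.c⟩ := by ext <;> simp [hg]
  induction n with
  | zero => ext <;> simp
  | succ n ih =>
    rw [zpow_add_one, ih]
    ext
    · simp; ring
    · simp; ring
    · simp only [mul_c, mul_assoc, hg]; push_cast; ring
  | pred n ih =>
    rw [zpow_sub_one, ih, h1]
    ext
    · simp; ring
    · simp; ring
    · simp only [mul_c, mul_neg, mul_assoc, hg]; push_cast; ring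

theorem pow_a (g : Heis R) (n : ℕ) : (g ^ n).a = n * g.a := by
  induction n with
  | zero => simp
  | succ n ih => rw [pow_succ, mul_a, ih]; push_cast; ring

theorem pow_b (g : Heis R) (n : ℕ) : (g ^ n).b = n * g.b := by
  induction n with
  | zero => simp
  | succ n ih => rw [pow_succ, mul_b, ih]; push_cast; ring

theorem pow_c (g : Heis R) (n : ℕ) : (g ^ n).c = n * g.c + (tri n : ℤ) * (g.a * g.b) := by
  induction n with
  | zero => simp [tri]
  | succ n ih =>
    rw [pow_succ, mul_c, ih, pow_a, Nat.cast_succ, Nat.cast_succ, tri_succ]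
    push_cast
    ring

theorem mem_center_iff {g : Heis R} : g ∈ Subgroup.center (Heis R) ↔ g.a = 0 ∧ g.b = 0 := by
  rw [Subgroup.mem_center_iff]
  constructor
  · intro hg
    have h1 := congrArg Heis.c (hg ⟨1, 0, 0⟩)
    have h2 := congrArg Heis.c (hg ⟨0, 1, 0⟩)
    simp only [mul_c, one_mul, mul_zero, add_zero, zero_add, zero_mul, mul_one] at h1 h2
    constructor
    · linear_combination -h2
    · linear_combination h1
  · rintro ⟨ha, hb⟩ x
    ext <;> simp [ha, hb, add_comm]

theorem mem_centerPow_iff {n : ℤ} {g : Heis R} :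
    g ∈ centerPow (Heis R) n ↔ g.a = 0 ∧ g.b = 0 ∧ ∃ t : R, g.c = n * t := by
  constructor
  · rintro ⟨y, hy, rfl⟩
    refine ⟨(mem_center_iff.1 y.2).1, (mem_center_iff.1 y.2).2, ?_⟩
    change y ∈ Subgroup.closure _ at hy
    induction hy using Subgroup.closure_induction with
    | mem x hx =>
      obtain ⟨t, rfl⟩ := hx
      refine ⟨t.1.c, ?_⟩
      have h1 := mem_center_iff.1 t.2
      rw [Subgroup.subtype_apply, Subgroup.coe_zpow, zpow_eq_of_mul_eq_zero (by simp [h1.1])]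
    | one => exact ⟨0, by simp⟩
    | mul x y _ _ hx hy =>
      obtain ⟨s, hs⟩ := hx
      obtain ⟨t, ht⟩ := hy
      refine ⟨s + t, ?_⟩
      rw [map_mul, mul_c, hs, ht, Subgroup.subtype_apply, (mem_center_iff.1 x.2).1]
      ring
    | inv x _ hx =>
      obtain ⟨s, hs⟩ := hx
      refine ⟨-s, ?_⟩
      rw [map_inv, inv_c, hs, Subgroup.subtype_apply, (mem_center_iff.1 x.2).1]
      ring
  · rintro ⟨ha, hb, t, ht⟩
    have h1 : (⟨0, 0, t⟩ : Heis R) ∈ Subgroup.center (Heis R) := mem_center_iff.2 ⟨rfl, rfl⟩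
    refine ⟨⟨⟨0, 0, t⟩, h1⟩ ^ n, Subgroup.subset_closure ⟨_, rfl⟩, ?_⟩
    rw [map_zpow, Subgroup.subtype_apply, zpow_eq_of_mul_eq_zero (by simp)]
    ext <;> simp [ha, hb, ht]

theorem comm_of_of : comm (⟨1, 0, 0⟩ : Heis R) ⟨0, 1, 0⟩ = ⟨0, 0, 1⟩ := by
  ext <;> simp [comm]

theorem macPair {α : ℤ} (hα : ((α - 1 : ℤ) : R) = 0) :
    MacPair α (⟨1, 0, 0⟩ : Heis R) ⟨0, 1, 0⟩ := by
  have hα' : (α : R) = 1 := by push_cast at hα; linear_combination hα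
  refine ⟨?_, ?_⟩
  · rw [comm_of_of, zpow_eq_of_mul_eq_zero (by simp)]
    ext <;> simp [conj, hα']
  · rw [comm_swap, comm_of_of, zpow_eq_of_mul_eq_zero (by simp)]
    ext <;> simp [conj, hα']

theorem normalForm_eq (i k j : ℤ) :
    (⟨1, 0, 0⟩ : Heis R) ^ i * ⟨0, 0, 1⟩ ^ k * ⟨0, 1, 0⟩ ^ j = ⟨i, j, k + i * j⟩ := by
  rw [zpow_eq_of_mul_eq_zero (by simp), zpow_eq_of_mul_eq_zero (by simp),
    zpow_eq_of_mul_eq_zero (by simp)]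
  ext <;> simp

/-- The coordinates of an element of the Heisenberg group. -/
def equivProd (R : Type*) : Heis R ≃ R × R × R where
  toFun g := (g.a, g.b, g.c)
  invFun p := ⟨p.1, p.2.1, p.2.2⟩
  left_inv _ := rfl
  right_inv _ := rfl

end Heis

namespace SylowPair

variable {T : Type*} [Group T] {h : ℕ} {v : ℤ} {a b : T}

theorem card_eq (S : SylowPair h v a b) : Nat.card T = 16 * h ^ 7 := by
  refine le_antisymm ?_ S.le_card
  have h0 : h ≠ 0 := by exact_mod_cast S.ne_zero
  have : NeZero (4 * h ^ 3) := ⟨by simp [h0]⟩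
  have : NeZero (2 * h ^ 2) := ⟨by simp [h0]⟩
  choose i k j hf using S.exists_nat_normalForm
  rw [← card_model]
  have : Finite (Model h) := Nat.finite_of_card_ne_zero (by rw [card_model]; positivity)
  refine Nat.card_le_card_of_injective (fun x => lat h (i x, k x, j x)) fun x y hxy => ?_
  rw [hf x, hf y]
  simpa only [zpow_natCast] using S.normalForm_congr hxy

/-- The group `T` has the universal property of the largest `2`-quotient of `G(α)`. -/
theorem exists_hom (S : SylowPair h v a b) {T' : Type*} [Group T'] {a' b' : T'}
    (h' : MacPair (1 + 2 * h * v) a' b') (hc : ∃ l, Nat.card T' = 2 ^ l) :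
    ∃ f : T →* T', f a = a' ∧ f b = b' := by
  have := S.finite
  have : Finite T' := by
    apply Nat.finite_of_card_ne_zero
    obtain ⟨l, hl⟩ := hc
    rw [hl]; positivity
  -- K satisfies the same axioms as T, so it has the same order and projects isomorphically onto T;
  -- the other projection then yields the homomorphism.
  let K : Subgroup (T × T') := Subgroup.closure {(a, a'), (b, b')}
  let p : K := ⟨(a, a'), Subgroup.subset_closure (by simp)⟩
  let q : K := ⟨(b, b'), Subgroup.subset_closure (by simp)⟩
  let f₁ : K →* T := (MonoidHom.fst T T').comp K.subtype
  let f₂ : K →* T' := (MonoidHom.snd T T').comp K.subtype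
  have hs : Function.Surjective f₁ := by
    rw [← MonoidHom.range_eq_top, ← top_le_iff, ← S.gen, Subgroup.closure_le]
    rintro x (rfl | rfl)
    · exact ⟨p, rfl⟩
    · exact ⟨q, rfl⟩
  have hK : SylowPair h v p q := by
    refine ⟨⟨?_, ?_⟩, ?_, S.two_pow, S.odd, ?_, ?_⟩
    · exact Subtype.ext (Prod.ext S.pair.left h'.left)
    · exact Subtype.ext (Prod.ext S.pair.right h'.right)
    · rw [← Subgroup.closure_closure_coe_preimage (k := {(a, a'), (b, b')})]
      congr 1
      ext x
      simp [p, q, Subtype.ext_iff, K]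
    · obtain ⟨l, hl⟩ := hc
      obtain ⟨l', hl'⟩ := S.card
      have h1 := Subgroup.card_subgroup_dvd_card K
      rw [Nat.card_prod, hl, hl', ← pow_add, Nat.dvd_prime_pow Nat.prime_two] at h1
      obtain ⟨k, -, hk⟩ := h1
      exact ⟨k, hk⟩
    · exact S.le_card.trans (Nat.card_le_card_of_surjective f₁ hs)
  have hb : Function.Bijective f₁ :=
    hs.bijective_of_nat_card_le (by rw [hK.card_eq, S.card_eq])
  let e : K ≃* T := MulEquiv.ofBijective f₁ hb
  have ha : e.symm a = p := e.symm_apply_eq.2 rfl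
  have hb : e.symm b = q := e.symm_apply_eq.2 rfl
  exact ⟨f₂.comp e.symm.toMonoidHom, by simp [ha, f₂, p], by simp [hb, f₂, q]⟩

theorem exists_hom_heis (S : SylowPair h v a b) : ∃ f : T →* Heis (ZMod (2 * h)),
    ∀ i k j : ℤ, f (a ^ i * comm a b ^ k * b ^ j) = ⟨i, j, k + i * j⟩ := by
  have h0 : h ≠ 0 := by exact_mod_cast S.ne_zero
  have : NeZero (2 * h) := ⟨by simp [h0]⟩
  have hz : ((2 * h : ℕ) : ZMod (2 * h)) = 0 := ZMod.natCast_self _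
  obtain ⟨f, ha, hb⟩ := S.exists_hom (T' := Heis (ZMod (2 * h)))
    (Heis.macPair (by push_cast at hz ⊢; linear_combination (v : ZMod (2 * h)) * hz)) (by
      obtain ⟨l, rfl⟩ := S.two_pow
      refine ⟨(l + 2) * 3, ?_⟩
      rw [Nat.card_congr (Heis.equivProd _), Nat.card_prod, Nat.card_prod, Nat.card_zmod]
      ring)
  refine ⟨f, fun i k j => ?_⟩
  rw [map_mul, map_mul, map_zpow, map_zpow, map_zpow, map_comm, ha, hb, Heis.comm_of_of,
    Heis.normalForm_eq]

theorem heis_mem_centerPow_iff {h : ℕ} (i k j : ℤ) :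
    (⟨i, j, k + i * j⟩ : Heis (ZMod (2 * h))) ∈ centerPow (Heis (ZMod (2 * h))) h ↔
      2 * (h : ℤ) ∣ i ∧ (h : ℤ) ∣ k ∧ 2 * (h : ℤ) ∣ j := by
  have key : ∀ i : ℤ, (i : ZMod (2 * h)) = 0 ↔ 2 * (h : ℤ) ∣ i := fun i => by
    rw [ZMod.intCast_zmod_eq_zero_iff_dvd]; push_cast; rfl
  rw [Heis.mem_centerPow_iff, key, key]
  constructor
  · rintro ⟨h1, h2, t, ht⟩
    refine ⟨h1, ?_, h2⟩
    obtain ⟨s, rfl⟩ := ZMod.intCast_surjective t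
    have h3 : ((k - h * s : ℤ) : ZMod (2 * h)) = 0 := by
      rw [(key i).2 h1] at ht
      push_cast
      simp at ht
      linear_combination ht
    obtain ⟨c, hc⟩ := (key _).1 h3
    exact ⟨s + 2 * c, by linear_combination hc⟩
  · rintro ⟨h1, ⟨c, hc⟩, h2⟩
    refine ⟨h1, h2, c, ?_⟩
    rw [(key i).2 h1, hc]
    push_cast
    ring

/-- On exponents both sides say 2h ∣ i, h ∣ k and 2h ∣ j. -/
theorem mem_three_iff_map_mem (S : SylowPair h v a b) {f : T →* Heis (ZMod (2 * h))}
    (hf : ∀ i k j : ℤ, f (a ^ i * comm a b ^ k * b ^ j) = ⟨i, j, k + i * j⟩) {x : T} :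
    x ∈ Subgroup.upperCentralSeries T 3 ↔ f x ∈ centerPow (Heis (ZMod (2 * h))) h := by
  obtain ⟨i, k, j, rfl⟩ := S.exists_nat_normalForm x
  have h1 := hf i k j
  rw [zpow_natCast, zpow_natCast, zpow_natCast] at h1
  rw [h1, heis_mem_centerPow_iff]
  refine ⟨S.dvd_of_mem_three, ?_⟩
  rintro ⟨h2, h3, h4⟩
  obtain ⟨i', rfl⟩ : 2 * h ∣ i := by exact_mod_cast h2
  obtain ⟨k', rfl⟩ : h ∣ k := by exact_mod_cast h3
  obtain ⟨j', rfl⟩ : 2 * h ∣ j := by exact_mod_cast h4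
  exact S.mem_three_iff.2 ⟨i', k', j', by simp only [zpow_natCast, pow_mul]⟩

theorem nonempty_quotient_mulEquiv (S : SylowPair h v a b) :
    Nonempty (T ⧸ Subgroup.upperCentralSeries T 3 ≃*
      Heis (ZMod (2 * h)) ⧸ centerPow (Heis (ZMod (2 * h))) h) := by
  obtain ⟨f, hf⟩ := S.exists_hom_heis
  let F := (QuotientGroup.mk' (centerPow (Heis (ZMod (2 * h))) h)).comp f
  have hF : Function.Surjective F := by
    refine (QuotientGroup.mk'_surjective _).comp fun g => ?_
    obtain ⟨i, hi⟩ := ZMod.intCast_surjective g.a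
    obtain ⟨j, hj⟩ := ZMod.intCast_surjective g.b
    obtain ⟨k, hk⟩ := ZMod.intCast_surjective (g.c - g.a * g.b)
    refine ⟨a ^ i * comm a b ^ k * b ^ j, ?_⟩
    rw [hf, hi, hj, hk]
    ext <;> simp
  have hker : Subgroup.upperCentralSeries T 3 = F.ker := by
    ext x
    rw [S.mem_three_iff_map_mem hf, MonoidHom.mem_ker]
    exact (QuotientGroup.eq_one_iff _).symm
  exact ⟨(QuotientGroup.quotientMulEquivOfEq hker).trans
    (QuotientGroup.quotientKerEquivOfSurjective F hF)⟩

/-! ### Exponent of the group, order and presentation of its third center. -/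

/-- In the Heisenberg group over ℤ/2h, a 2h-th power has only the corner entry `tri (2h)` times ab,
and `tri (2h)` = h(2h-1). -/
theorem pow_mem_three (S : SylowPair h v a b) (x : T) :
    x ^ (2 * h) ∈ Subgroup.upperCentralSeries T 3 := by
  obtain ⟨f, hf⟩ := S.exists_hom_heis
  have hz : ((2 * h : ℕ) : ZMod (2 * h)) = 0 := ZMod.natCast_self _
  rw [S.mem_three_iff_map_mem hf, map_pow, Heis.mem_centerPow_iff, Heis.pow_a, Heis.pow_b,
    Heis.pow_c, hz]
  refine ⟨zero_mul _, zero_mul _, ((2 * h - 1 : ℤ) : ZMod (2 * h)) * ((f x).a * (f x).b), ?_⟩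
  have ht : tri (2 * h : ℕ) = h * (2 * h - 1) := by
    have := two_mul_tri (2 * h : ℕ)
    push_cast at this ⊢
    linarith
  rw [ht]
  push_cast
  ring

theorem left_pow_pow (S : SylowPair h v a b) : (a ^ (2 * h)) ^ (2 * h ^ 2) = 1 := by
  have := S.left_pow 1
  rw [← pow_mul, ← zpow_natCast, ← this]
  congr 1; push_cast; ring

theorem comm_pow_pow (S : SylowPair h v a b) : (comm a b ^ h) ^ (2 * h ^ 2) = 1 := by
  obtain ⟨g, hg⟩ := S.even
  rw [← pow_mul, ← zpow_natCast,
    show ((h * (2 * h ^ 2) : ℕ) : ℤ) = 2 * h ^ 2 * h by push_cast; ring,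
    S.comm_zpow_eq, ← S.left_pow g]
  congr 1
  linear_combination 2 * (h : ℤ) ^ 3 * hg

theorem pow_eq_one_of_mem_three (S : SylowPair h v a b) {x : T}
    (hx : x ∈ Subgroup.upperCentralSeries T 3) : x ^ (2 * h ^ 2) = 1 := by
  obtain ⟨i, k, j, rfl⟩ := S.mem_three_iff.1 hx
  have key : ∀ (y : T) (n : ℤ), y ^ (2 * h ^ 2) = 1 → (y ^ n) ^ (2 * h ^ 2) = 1 := by
    intro y n hy
    rw [← zpow_natCast, zpow_comm, zpow_natCast, hy, one_zpow]
  rw [Commute.mul_pow, Commute.mul_pow, key _ _ S.left_pow_pow, key _ _ S.comm_pow_pow,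
    key _ _ S.swap.left_pow_pow, one_mul, one_mul]
  · exact S.commute_left_comm.zpow_zpow _ _
  · exact (S.commute_left_right.zpow_zpow _ _).mul_left (S.commute_right_comm.symm.zpow_zpow _ _)

theorem exponent_eq (S : SylowPair h v a b) : Monoid.exponent T = 4 * h ^ 3 := by
  apply Nat.dvd_antisymm
  · refine Monoid.exponent_dvd_of_forall_pow_eq_one fun x => ?_
    rw [show 4 * h ^ 3 = 2 * h * (2 * h ^ 2) by ring, pow_mul]
    exact S.pow_eq_one_of_mem_three (S.pow_mem_three x)
  · have h1 : a ^ (Monoid.exponent T : ℤ) = 1 := by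
      rw [zpow_natCast, Monoid.pow_exponent_eq_one]
    exact_mod_cast S.dvd_of_left_zpow_eq_one h1

/-- The lattice of relations rescaled by (2h, h, 2h). Its generators (2h², 0, 0), (-h², 2h, 0), (h,
0, h) are the noncommutator relators of the presentation, and its index is 4h⁴. -/
theorem normalForm_three_eq_iff (S : SylowPair h v a b) {i k j i' k' j' : ℤ} :
    (a ^ (2 * h)) ^ i * (comm a b ^ h) ^ k * (b ^ (2 * h)) ^ j =
      (a ^ (2 * h)) ^ i' * (comm a b ^ h) ^ k' * (b ^ (2 * h)) ^ j' ↔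
    ∃ x y z : ℤ, i = i' + 2 * h ^ 2 * x + h * z - h ^ 2 * y ∧ k = k' + 2 * h * y ∧
      j = j' + h * z := by
  have h0 := S.ne_zero
  have h2 := mul_ne_zero two_ne_zero h0
  have h1 : ∀ (x : T) (n : ℕ) (i : ℤ), (x ^ n) ^ i = x ^ (n * i) := fun x n i => by
    rw [zpow_mul, zpow_natCast]
  simp only [h1]
  rw [S.normalForm_eq_iff, lat_eq_iff]
  refine exists_congr fun x => exists_congr fun y => exists_congr fun z => ?_
  push_cast
  constructor
  · rintro ⟨e1, e2, e3⟩
    refine ⟨mul_left_cancel₀ h2 ?_, mul_left_cancel₀ h0 ?_,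
      mul_left_cancel₀ h2 ?_⟩
    · linear_combination e1
    · linear_combination e2
    · linear_combination e3
  · rintro ⟨rfl, rfl, rfl⟩
    exact ⟨by ring, by ring, by ring⟩

theorem card_three (S : SylowPair h v a b) :
    Nat.card (Subgroup.upperCentralSeries T 3) = 4 * h ^ 4 := by
  have h0 : h ≠ 0 := by exact_mod_cast S.ne_zero
  let F : Fin (2 * h ^ 2) × Fin (2 * h) × Fin h → Subgroup.upperCentralSeries T 3 := fun p =>
    ⟨_, S.mem_three_iff.2 ⟨p.1, p.2.1, p.2.2, rfl⟩⟩
  have hfin : ∀ (n : ℕ) (i : ℤ), n ≠ 0 → ∃ (p : Fin n) (q : ℤ), i = p + n * q := by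
    intro n i hn
    have hn' : (n : ℤ) ≠ 0 := by exact_mod_cast hn
    refine ⟨⟨(i % n).toNat, ?_⟩, i / n, ?_⟩
    · have := Int.emod_lt_of_pos i (b := n) (by omega)
      have := Int.emod_nonneg i hn'
      omega
    · simp only [Int.toNat_of_nonneg (Int.emod_nonneg i hn')]
      exact (Int.emod_add_mul_ediv i n).symm
  have hfin' : ∀ (n : ℕ) (p q : Fin n) (t : ℤ), (p : ℤ) = q + n * t → p = q := by
    intro n p q t e
    have h1 : ((p : ℕ) : ℤ) ≡ ((q : ℕ) : ℤ) [ZMOD n] := by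
      rw [e]; exact Int.modEq_iff_dvd.2 ⟨-t, by ring⟩
    have h2 := Int.natCast_modEq_iff.1 h1
    exact Fin.ext (h2.eq_of_lt_of_lt p.2 q.2)
  have hF : Function.Bijective F := by
    constructor
    · rintro ⟨i, k, j⟩ ⟨i', k', j'⟩ e
      obtain ⟨x, y, z, e1, e2, e3⟩ := S.normalForm_three_eq_iff.1 (congrArg Subtype.val e)
      have hj := hfin' _ j j' z e3
      have hk := hfin' _ k k' y (by push_cast; exact e2)
      have hz : z = 0 := by
        rw [hj] at e3
        have : (h : ℤ) * z = 0 := by linarith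
        simpa [h0] using this
      have hy : y = 0 := by
        rw [hk] at e2
        have : (h : ℤ) * y = 0 := by linarith
        simpa [h0] using this
      have hi := hfin' _ i i' x (by rw [hz, hy] at e1; push_cast; linarith)
      rw [hi, hj, hk]
    · rintro ⟨g, hg⟩
      obtain ⟨i, k, j, rfl⟩ := S.mem_three_iff.1 hg
      obtain ⟨k', y, hk⟩ := hfin (2 * h) k (by simp [h0])
      obtain ⟨j', z, hj⟩ := hfin h j h0
      -- The lattice is triangular: reducing k and j alters the exponent of a, which is therefore
      -- reduced last.
      obtain ⟨i', x, hi⟩ := hfin (2 * h ^ 2) (i - h * z + h ^ 2 * y) (by simp [h0])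
      refine ⟨(i', k', j'), Subtype.ext ?_⟩
      refine (S.normalForm_three_eq_iff.2 ⟨x, y, z, ?_, ?_, hj⟩).symm
      · push_cast at hi; linear_combination hi
      · push_cast at hk; exact hk
  rw [← Nat.card_congr (Equiv.ofBijective F hF)]
  simp
  ring

end SylowPair

theorem exists_of_mem_closure_triple {P : Type*} [Group P] {x y z : P} (hxy : Commute x y)
    (hxz : Commute x z) (hyz : Commute y z) {g : P} (hg : g ∈ Subgroup.closure {x, y, z}) :
    ∃ i k j : ℤ, g = x ^ i * z ^ k * y ^ j := by
  induction hg using Subgroup.closure_induction with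
  | mem g hg =>
    rcases hg with rfl | rfl | rfl
    · exact ⟨1, 0, 0, by simp⟩
    · exact ⟨0, 0, 1, by simp⟩
    · exact ⟨0, 1, 0, by simp⟩
  | one => exact ⟨0, 0, 0, by simp⟩
  | mul g g' _ _ h1 h2 =>
    obtain ⟨i, k, j, rfl⟩ := h1
    obtain ⟨i', k', j', rfl⟩ := h2
    refine ⟨i + i', k + k', j + j', ?_⟩
    have e1 := (hxy.zpow_zpow i' j).eq
    have e2 := (hxz.zpow_zpow i' k).eq
    have e3 := (hyz.zpow_zpow j k').eq
    rw [zpow_add, zpow_add, zpow_add]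
    calc x ^ i * z ^ k * y ^ j * (x ^ i' * z ^ k' * y ^ j')
        = x ^ i * z ^ k * (y ^ j * x ^ i') * z ^ k' * y ^ j' := by simp only [mul_assoc]
      _ = x ^ i * (z ^ k * x ^ i') * (y ^ j * z ^ k') * y ^ j' := by
        rw [← e1]; simp only [mul_assoc]
      _ = _ := by rw [← e2, e3]; simp only [mul_assoc]
  | inv g _ h1 =>
    obtain ⟨i, k, j, rfl⟩ := h1
    refine ⟨-i, -k, -j, ?_⟩
    rw [mul_inv_rev, mul_inv_rev, ← zpow_neg, ← zpow_neg, ← zpow_neg,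
      (hxz.symm.zpow_zpow _ _).eq, (((hxy.symm.zpow_zpow _ _)).mul_right (hyz.zpow_zpow _ _)).eq]

namespace SylowPair

variable {T : Type*} [Group T] {h : ℕ} {v : ℤ} {a b : T}

/-- The commutation relators bring each element of the presented group to the form X^i W^k Y^j; if
its image is trivial, the exponents lie in the lattice, and the remaining relators make it trivial.
-/
theorem nonempty_three_mulEquiv {m : ℕ} (S : SylowPair (2 ^ (m - 1)) v a b) (hm : 1 < m) :
    Nonempty (Subgroup.upperCentralSeries T 3 ≃* PresentedGroup (thirdCenterRels m)) := by
  obtain ⟨n, rfl⟩ : ∃ n, m = n + 1 := ⟨m - 1, by omega⟩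
  obtain ⟨h, hh⟩ : ∃ h, h = 2 ^ n := ⟨_, rfl⟩
  have e1 : 2 ^ (n + 1 - 1) = h := by rw [hh]; rfl
  have e2 : 2 ^ (n + 1) = 2 * h := by rw [hh]; ring
  have e3 : 2 ^ (2 * (n + 1) - 2) = h ^ 2 := by
    rw [hh, ← pow_mul]; congr 1; omega
  have e4 : 2 ^ (2 * (n + 1) - 1) = 2 * h ^ 2 := by
    rw [hh, ← pow_mul, ← pow_succ']; congr 1; omega
  rw [e1] at S
  let Z := Subgroup.upperCentralSeries T 3
  let x : Z := ⟨a ^ (2 * h), S.left_pow_mem_three⟩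
  let y : Z := ⟨b ^ (2 * h), S.right_pow_mem_three⟩
  let z : Z := ⟨comm a b ^ h, Subgroup.upperCentralSeries_mono T (by norm_num) S.comm_pow_mem_two⟩
  have hrel : ∀ r ∈ thirdCenterRels (n + 1), FreeGroup.lift ![x, y, z] r = 1 := by
    have hr1 := (S.right_zpow_eq 1)
    have hr2 := (S.comm_zpow_eq 1)
    rintro r (rfl | rfl | rfl | rfl | rfl | rfl)
    · simp only [map_mul, map_inv, FreeGroup.lift_apply_of]
      rw [mul_inv_eq_one]
      exact Subtype.ext S.commute_left_right
    · simp only [map_mul, map_inv, FreeGroup.lift_apply_of]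
      rw [mul_inv_eq_one]
      exact Subtype.ext S.commute_left_comm
    · simp only [map_mul, map_inv, FreeGroup.lift_apply_of]
      rw [mul_inv_eq_one]
      exact Subtype.ext S.commute_right_comm
    · simp only [map_mul, map_inv, map_pow, FreeGroup.lift_apply_of]
      rw [mul_inv_eq_one, e2, e3]
      refine Subtype.ext ?_
      change (a ^ (2 * h)) ^ h ^ 2 = (comm a b ^ h) ^ (2 * h)
      rw [← pow_mul, ← pow_mul, ← zpow_natCast, ← zpow_natCast,
        show ((h * (2 * h) : ℕ) : ℤ) = 2 * h ^ 2 * 1 by push_cast; ring, hr2]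
      congr 1; push_cast; ring
    · simp only [map_mul, map_pow, FreeGroup.lift_apply_of]
      rw [e1]
      refine Subtype.ext ?_
      change (a ^ (2 * h)) ^ h * (b ^ (2 * h)) ^ h = 1
      rw [← pow_mul, ← pow_mul, ← zpow_natCast, ← zpow_natCast,
        show ((2 * h * h : ℕ) : ℤ) = 2 * h ^ 2 * 1 by push_cast; ring, hr1, zpow_neg,
        mul_inv_cancel]
    · simp only [map_pow, FreeGroup.lift_apply_of]
      rw [e4]
      exact Subtype.ext S.left_pow_pow
  let f : PresentedGroup (thirdCenterRels (n + 1)) →* Z := PresentedGroup.toGroup hrel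
  let X : PresentedGroup (thirdCenterRels (n + 1)) := PresentedGroup.of 0
  let Y : PresentedGroup (thirdCenterRels (n + 1)) := PresentedGroup.of 1
  let W : PresentedGroup (thirdCenterRels (n + 1)) := PresentedGroup.of 2
  have hfX : f X = x := PresentedGroup.toGroup.of hrel
  have hfY : f Y = y := PresentedGroup.toGroup.of hrel
  have hfW : f W = z := PresentedGroup.toGroup.of hrel
  have hone : ∀ r ∈ thirdCenterRels (n + 1), PresentedGroup.mk (thirdCenterRels (n + 1)) r = 1 :=
    fun r hr => PresentedGroup.one_of_mem hr
  have hXY : Commute X Y := by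
    have := hone _ (Or.inl rfl)
    rwa [map_mul, map_inv, mul_inv_eq_one] at this
  have hXW : Commute X W := by
    have := hone _ (Or.inr (Or.inl rfl))
    rwa [map_mul, map_inv, mul_inv_eq_one] at this
  have hYW : Commute Y W := by
    have := hone _ (Or.inr (Or.inr (Or.inl rfl)))
    rwa [map_mul, map_inv, mul_inv_eq_one] at this
  have hX2W : X ^ h ^ 2 = W ^ (2 * h) := by
    have := hone _ (Or.inr (Or.inr (Or.inr (Or.inl rfl))))
    rwa [map_mul, map_inv, mul_inv_eq_one, map_pow, map_pow, e2, e3] at this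
  have hX1Y : X ^ h * Y ^ h = 1 := by
    have := hone _ (Or.inr (Or.inr (Or.inr (Or.inr (Or.inl rfl)))))
    rwa [map_mul, map_pow, map_pow, e1] at this
  have hX : X ^ (2 * h ^ 2) = 1 := by
    have := hone _ (Or.inr (Or.inr (Or.inr (Or.inr (Or.inr rfl)))))
    rwa [map_pow, e4] at this
  have hgen : ∀ g : PresentedGroup (thirdCenterRels (n + 1)),
      ∃ i k j : ℤ, g = X ^ i * W ^ k * Y ^ j := by
    intro g
    refine exists_of_mem_closure_triple hXY hXW hYW ?_
    have : (Set.range PresentedGroup.of : Set (PresentedGroup (thirdCenterRels (n + 1))))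
        ⊆ {X, Y, W} := by
      rintro _ ⟨i, rfl⟩
      fin_cases i
      · exact Or.inl rfl
      · exact Or.inr (Or.inl rfl)
      · exact Or.inr (Or.inr rfl)
    exact Subgroup.closure_mono this
      (by rw [PresentedGroup.closure_range_of]; exact Subgroup.mem_top g)
  have hval : ∀ i k j : ℤ, (f (X ^ i * W ^ k * Y ^ j) : T)
      = (a ^ (2 * h)) ^ i * (comm a b ^ h) ^ k * (b ^ (2 * h)) ^ j := by
    intro i k j
    rw [map_mul, map_mul, map_zpow, map_zpow, map_zpow, hfX, hfY, hfW]
    rfl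
  refine ⟨(MulEquiv.ofBijective f ⟨?_, ?_⟩).symm⟩
  · rw [injective_iff_map_eq_one]
    intro g hg
    obtain ⟨i, k, j, rfl⟩ := hgen g
    have h1 := hval i k j
    rw [hg] at h1
    have h2 : (a ^ (2 * h)) ^ i * (comm a b ^ h) ^ k * (b ^ (2 * h)) ^ j =
        (a ^ (2 * h)) ^ (0 : ℤ) * (comm a b ^ h) ^ (0 : ℤ) * (b ^ (2 * h)) ^ (0 : ℤ) := by
      rw [← h1]; simp
    obtain ⟨s, t, r, rfl, rfl, rfl⟩ := S.normalForm_three_eq_iff.1 h2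
    have hX1Y' : Y ^ h = (X ^ h)⁻¹ := eq_inv_of_mul_eq_one_right hX1Y
    have c1 : X ^ (2 * h ^ 2 * s : ℤ) = 1 := by
      rw [zpow_mul, show (2 * h ^ 2 : ℤ) = ((2 * h ^ 2 : ℕ) : ℤ) by push_cast; rfl, zpow_natCast,
        hX, one_zpow]
    have c2 : W ^ (2 * h * t : ℤ) = X ^ (h ^ 2 * t : ℤ) := by
      rw [zpow_mul, zpow_mul X, show (2 * h : ℤ) = ((2 * h : ℕ) : ℤ) by push_cast; rfl,
        zpow_natCast, ← hX2W, show (h ^ 2 : ℤ) = ((h ^ 2 : ℕ) : ℤ) by push_cast; rfl, zpow_natCast]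
    have c3 : Y ^ (h * r : ℤ) = X ^ (-(h * r) : ℤ) := by
      rw [zpow_mul, zpow_natCast, hX1Y', zpow_neg, zpow_mul, zpow_natCast, inv_zpow]
    rw [zero_add, zero_add, zero_add, c2, c3, ← zpow_add, ← zpow_add, ← c1]
    congr 1; ring
  · rintro ⟨g, hg⟩
    obtain ⟨i, k, j, rfl⟩ := S.mem_three_iff.1 hg
    exact ⟨X ^ i * W ^ k * Y ^ j, Subtype.ext (hval i k j)⟩

end SylowPair

/-! ### Passage from the Macdonald group to its Sylow subgroup. -/

/-- A finite nilpotent group is the direct product of its Sylow subgroups, and the map is a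
projection. -/
theorem exists_surjective_sylow {G : Type*} [Group G] [Finite G] [Group.IsNilpotent G]
    {p : ℕ} (hp : p ∈ (Nat.card G).primeFactors) (P : Sylow p G) :
    ∃ f : G →* (P : Subgroup G), Function.Surjective f := by
  obtain ⟨e⟩ := ((Group.isNilpotent_of_finite_tfae (G := G)).out 0 4).1 ‹_›
  let q : (Nat.card G).primeFactors := ⟨p, hp⟩
  let f : (∀ p : (Nat.card G).primeFactors, ∀ P : Sylow p G, (P : Subgroup G)) →*
      (P : Subgroup G) :=
    (Pi.evalMonoidHom (fun P : Sylow q G => (P : Subgroup G)) P).comp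
      (Pi.evalMonoidHom (fun p : (Nat.card G).primeFactors => ∀ P : Sylow p G, (P : Subgroup G)) q)
  refine ⟨f.comp e.symm.toMonoidHom, ?_⟩
  have hf : Function.Surjective f :=
    (Function.surjective_eval (β := fun P : Sylow q G => (P : Subgroup G)) P).comp
      (Function.surjective_eval q)
  exact hf.comp e.symm.surjective

theorem exists_sylowPair {h l : ℕ} (hh : h = 2 ^ (l + 1)) {v : ℤ} (hv : Odd v)
    (J : Sylow 2 (MacdonaldGroup (1 + 2 * h * v))) :
    ∃ a b : (J : Subgroup (MacdonaldGroup (1 + 2 * h * v))), SylowPair h v a b := by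
  have he : Even h := by rw [hh, pow_succ']; exact even_two_mul _
  have h0 : h ≠ 0 := by rw [hh]; positivity
  obtain ⟨g, hg⟩ := he.two_dvd
  have h3 : IsCoprime (h : ℤ) 3 := by
    rw [hh]; push_cast
    exact IsCoprime.pow_left ⟨-1, 1, by norm_num⟩
  have hu : ¬ IsUnit (1 + 2 * h * v : ℤ) := by
    rw [Int.isUnit_iff, hg]
    push_cast
    rintro (e | e)
    · have : (4 * g : ℤ) * v = 0 := by linarith
      rcases mul_eq_zero.1 this with h1 | h1
      · omega
      · rw [h1] at hv; simp at hv
    · have : 4 * (g * v : ℤ) = -2 := by linarith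
      omega
  have hp := macPair_of (1 + 2 * h * v)
  have hgen := closure_of (1 + 2 * h * v)
  have hfin := hp.finite hgen hu
  have hnil := hp.isNilpotent hgen hu (w := h * v) (by ring) ⟨g * v, by rw [hg]; push_cast; ring⟩
  have hdvd := card_model_dvd h0 he h3 hv
  have e16 : 16 * h ^ 7 = 2 ^ (4 + (l + 1) * 7) := by rw [hh]; ring
  have hdvd' := e16 ▸ hdvd
  obtain ⟨f, hf⟩ := exists_surjective_sylow (Nat.mem_primeFactors.2 ⟨Nat.prime_two,
    (dvd_pow_self 2 (by omega)).trans hdvd', Nat.card_pos.ne'⟩) J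
  refine ⟨f (PresentedGroup.of 0), f (PresentedGroup.of 1), hp.map f, ?_, ⟨l, hh⟩, hv,
    ⟨_, J.card_eq_multiplicity⟩, ?_⟩
  · rw [← Set.image_pair, ← MonoidHom.map_closure, hgen, Subgroup.map_top_of_surjective f hf]
  · refine Nat.le_of_dvd Nat.card_pos ?_
    rw [e16]
    exact J.pow_dvd_card_of_pow_dvd_card hdvd'

end Macdonald

theorem proposition9p2 (α : ℤ) (m : ℕ) (hm : 1 < m) (hα : padicValInt 2 (α - 1) = m)
    (J : Sylow 2 (Macdonald.MacdonaldGroup α)) :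
    (∀ x ∈ Subgroup.upperCentralSeries J 3, ∀ y ∈ Subgroup.upperCentralSeries J 3,
      x * y = y * x) ∧
    Nat.card (Subgroup.upperCentralSeries J 3) = 2 ^ (4 * m - 2) ∧
    Nonempty (Subgroup.upperCentralSeries J 3 ≃*
      PresentedGroup (Macdonald.thirdCenterRels m)) ∧
    Nonempty (J ⧸ Subgroup.upperCentralSeries J 3 ≃*
      Macdonald.Heis (ZMod (2 ^ m)) ⧸
        Macdonald.centerPow (Macdonald.Heis (ZMod (2 ^ m))) (2 ^ (m - 1))) ∧
    Monoid.exponent J = 2 ^ (3 * m - 1) := by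
  have hm2 : 2 ^ m = 2 * 2 ^ (m - 1) := by rw [← pow_succ']; congr 1; omega
  have h1 : α - 1 ≠ 0 := by
    intro h
    rw [h, padicValInt.zero] at hα
    omega
  obtain ⟨v, hv⟩ : (2 : ℤ) ^ m ∣ α - 1 := by
    rw [← hα]; exact_mod_cast padicValInt_dvd (p := 2) (α - 1)
  have hodd : Odd v := by
    rw [← Int.not_even_iff_odd]
    rintro ⟨w, rfl⟩
    have h2 : ((2 : ℕ) : ℤ) ^ (m + 1) ∣ α - 1 := ⟨w, by rw [hv]; push_cast; ring⟩
    rw [padicValInt_dvd_iff] at h2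
    rcases h2 with h2 | h2
    · exact h1 h2
    · omega
  obtain rfl : α = 1 + 2 * (2 ^ (m - 1) : ℕ) * v := by
    have hm3 : (2 : ℤ) ^ m = 2 * 2 ^ (m - 1) := by exact_mod_cast hm2
    rw [hm3] at hv
    push_cast
    linarith
  -- Here m > 1 makes m - 1 = (m - 2) + 1, so that h = 2^(m-1) is even.
  obtain ⟨a, b, S⟩ := Macdonald.exists_sylowPair (l := m - 2) (by congr 1; omega) hodd J
  refine ⟨fun x hx y hy => (S.commute_of_mem_three hx hy).eq, ?_, S.nonempty_three_mulEquiv hm,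
    ?_, ?_⟩
  · rw [S.card_three, ← pow_mul, show 4 = 2 ^ 2 by rfl, ← pow_add]
    congr 1; omega
  · rw [hm2]
    have := S.nonempty_quotient_mulEquiv
    push_cast at this
    exact this
  · rw [S.exponent_eq, ← pow_mul, show 4 = 2 ^ 2 by rfl, ← pow_add]
    congr 1; omega
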